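/- **Theorem (Kim–Rolfsen).** Let $n\ge 0$, let $B_n$ be the braid group with its standard generators $\sigma_1,\dots,\sigma_{n-1}$ and relations $\sigma_i\sigma_j=\sigma_j\sigma_i$ ($|i-j|>1$), $\sigma_i\sigma_j\sigma_i=\sigma_j\sigma_i\sigma_j$ ($|i-j|=1$), and let $P_n$ be the pure braid group, that is, the kernel of the homomorphism $B_n\to\Sigma_n$, $\sigma_i\mapsto(i\ \,i{+}1)$. For $1\le i<j\le n$ put $$\alpha_{ij}=\sigma_{j-1}\sigma_{j-2}\cdots\sigma_{i+1}\,\sigma_i^2\,\sigma_{i+1}^{-1}\cdots\sigma_{j-2}^{-1}\sigma_{j-1}^{-1},$$ and for $1\le k\le n-1$ let $F_k$ be the free group on $x_1,\dots,x_k$, mapped to $B_n$ by $x_i\mapsto\alpha_{i,k+1}$. Then every $\beta\in P_n$ is, for exactly one vector $(\beta_1,\dots,\beta_{n-1})\in F_1\times\cdots\times F_{n-1}$ (the Artin coordinates of $\beta$), the product $\beta_1\beta_2\cdots\beta_{n-1}$ of the images of the $\beta_k$ in $B_n$. Order each $F_k$ by the Magnus ordering: expand $u\in F_k$ as a formal power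 series over $\mathbb Z$ in non-commuting variables $X_1,\dots,X_k$ by the multiplicative map with $x_i\mapsto 1+X_i$, list the monomials by increasing degree and lexicographically by subscripts within each degree, and put $u<v$ if, at the first monomial where the coefficients of the series of $u$ and $v$ differ, the coefficient of $u$ is the smaller one. For $\alpha,\beta\in P_n$ put $\alpha<\beta$ if, at the first $k$ with $\alpha_k\neq\beta_k$, one has $\alpha_k<\beta_k$ in the Magnus ordering of $F_k$. Then $<$ is a bi-ordering of $P_n$: it is a strict total ordering, and $x<y$ implies $xz<yz$ and $zx<zy$ for all $x,y,z\in P_n$. Call a braid Garside-positive if it is a product of generators $\sigma_i$, with only positive exponents. Every non-trivial Garside-positive pure braid is greater than the identity, and the set of all Garside-positive pure braids (including the identity) is well-ordered by $<$. -/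

import Mathlib

/-! ### Braid groups and pure braid groups -/

/-- The defining relators of the braid group on `n` strands, with generators indexed by
`0, …, n - 2`: far commutativity `σ i σ j = σ j σ i` for `|i - j| > 1` and the braid relation
`σ i σ j σ i = σ j σ i σ j` for `|i - j| = 1` (each unordered pair `{i, j}` is listed once). -/
def braidRels (n : ℕ) : Set (FreeGroup (Fin (n - 1))) :=
  {r | ∃ i j : Fin (n - 1), (i : ℕ) + 1 < j ∧
      r = (FreeGroup.of i * FreeGroup.of j) * (FreeGroup.of j * FreeGroup.of i)⁻¹} ∪
  {r | ∃ i j : Fin (n - 1), (i : ℕ) + 1 = j ∧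
      r = (FreeGroup.of i * FreeGroup.of j * FreeGroup.of i) *
        (FreeGroup.of j * FreeGroup.of i * FreeGroup.of j)⁻¹}

/-- The braid group on `n` strands (Artin's presentation). -/
abbrev BraidGroup (n : ℕ) : Type := PresentedGroup (braidRels n)

/-- The standard generator; `σ i` crosses the strands in positions `i` and `i + 1`
(positions are numbered `0, …, n - 1`). -/
def BraidGroup.σ {n : ℕ} (i : Fin (n - 1)) : BraidGroup n := PresentedGroup.of i

/-- The transposition of the positions `i` and `i + 1`. -/
def adjacentSwap {n : ℕ} (i : Fin (n - 1)) : Equiv.Perm (Fin n) :=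
  Equiv.swap ⟨i, by omega⟩ ⟨(i : ℕ) + 1, by omega⟩

theorem adjacentSwap_braidRels (n : ℕ) :
    ∀ r ∈ braidRels n, FreeGroup.lift (adjacentSwap (n := n)) r = 1 := by
  rintro r (⟨i, j, hij, rfl⟩ | ⟨i, j, hij, rfl⟩)
  · simp only [map_mul, map_inv, FreeGroup.lift_apply_of, mul_inv_eq_one, adjacentSwap]
    refine (Equiv.Perm.disjoint_swap_swap ?_).commute.eq
    simp only [List.nodup_cons, List.mem_cons, Fin.mk.injEq, List.not_mem_nil, or_false,
      not_false_eq_true, List.nodup_nil, and_true, not_or]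
    omega
  · simp only [map_mul, map_inv, FreeGroup.lift_apply_of, mul_inv_eq_one, adjacentSwap]
    have h : (⟨(j : ℕ), by omega⟩ : Fin n) = ⟨(i : ℕ) + 1, by omega⟩ := Fin.ext hij.symm
    rw [h]
    generalize hx : (⟨(i : ℕ), by omega⟩ : Fin n) = x
    generalize hy : (⟨(i : ℕ) + 1, by omega⟩ : Fin n) = y
    generalize hz : (⟨(j : ℕ) + 1, by omega⟩ : Fin n) = z
    have hxy : x ≠ y := by rw [← hx, ← hy, Ne, Fin.mk.injEq]; omega
    have hxz : x ≠ z := by rw [← hx, ← hz, Ne, Fin.mk.injEq]; omega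
    have hyz : y ≠ z := by rw [← hy, ← hz, Ne, Fin.mk.injEq]; omega
    rw [Equiv.swap_mul_swap_mul_swap hxy hxz, Equiv.swap_comm x y, Equiv.swap_comm y z,
      Equiv.swap_mul_swap_mul_swap hyz.symm hxz.symm, Equiv.swap_comm]

/-- The permutation of the strands induced by a braid. -/
def BraidGroup.toPerm (n : ℕ) : BraidGroup n →* Equiv.Perm (Fin n) :=
  PresentedGroup.toGroup (adjacentSwap_braidRels n)

/-- The pure braid group on `n` strands. -/
abbrev PureBraidGroup (n : ℕ) : Subgroup (BraidGroup n) := (BraidGroup.toPerm n).ker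

/-- A pure braid is Garside-positive if it can be written as a word in the standard generators
with only positive exponents. -/
def GarsidePositive {n : ℕ} (β : PureBraidGroup n) : Prop :=
  (β : BraidGroup n) ∈ Submonoid.closure (Set.range (BraidGroup.σ (n := n)))

/-! ### Artin coordinates -/

/-- For `i ≤ k`, the pure braid
`σ k σ (k-1) ⋯ σ (i+1) (σ i)² (σ (i+1))⁻¹ ⋯ (σ (k-1))⁻¹ (σ k)⁻¹`
linking the strands `i` and `k + 1` (numbered from `0`). -/
def pureGen {n : ℕ} (k : Fin (n - 1)) (i : Fin ((k : ℕ) + 1)) : BraidGroup n :=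
  let u : BraidGroup n :=
    (((List.finRange (n - 1)).filter (fun m : Fin (n - 1) => (i : ℕ) < (m : ℕ) ∧ m ≤ k)).reverse.map
      BraidGroup.σ).prod
  u * BraidGroup.σ ⟨i, by omega⟩ ^ 2 * u⁻¹

/-- The `k`-th free factor (`k` from `0`): the free group on `k + 1` generators, mapped to the
braids in which the strand `k + 1` winds around the strands `0, …, k`. -/
def freeFactor {n : ℕ} (k : Fin (n - 1)) : FreeGroup (Fin ((k : ℕ) + 1)) →* BraidGroup n :=
  FreeGroup.lift (pureGen k)

/-- `w = (w 0, …, w (n - 2))` is a vector of Artin coordinates of the pure braid `β`: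
`β = β₁ β₂ ⋯ β_{n-1}`, where `β_{k+1}` is the element `w k` of the `k`-th free factor. -/
def IsArtinCoordinates {n : ℕ} (β : PureBraidGroup n)
    (w : (k : Fin (n - 1)) → FreeGroup (Fin ((k : ℕ) + 1))) : Prop :=
  (β : BraidGroup n) = (List.ofFn (fun k => freeFactor k (w k))).prod

/-! ### The Magnus ordering of a free group -/

/-- Formal power series with integer coefficients in the non-commuting variables
`X 0, …, X (k - 1)`. The list `[i₁, …, i_d]` stands for the monomial `X i₁ ⋯ X i_d`, and a series
is given by its coefficients. -/
def NCSeries (k : ℕ) : Type := List (Fin k) → ℤ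

namespace NCSeries

variable {k : ℕ}

@[ext] theorem ext {f g : NCSeries k} (h : ∀ w, f w = g w) : f = g := funext h

instance instAddCommGroup : AddCommGroup (NCSeries k) := inferInstanceAs (AddCommGroup (List (Fin k) → ℤ))

instance : One (NCSeries k) := ⟨fun w => if w = [] then 1 else 0⟩

/-- The coefficient of `w` in `f * g` is the sum of `f u * g v` over all factorizations
`w = u v`. -/
instance : Mul (NCSeries k) :=
  ⟨fun f g w => ∑ p ∈ Finset.range (w.length + 1), f (w.take p) * g (w.drop p)⟩

theorem add_coeff (f g : NCSeries k) (w : List (Fin k)) : (f + g) w = f w + g w := rfl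

theorem zero_coeff (w : List (Fin k)) : (0 : NCSeries k) w = 0 := rfl

theorem one_coeff (w : List (Fin k)) : (1 : NCSeries k) w = if w = [] then 1 else 0 := rfl

theorem mul_coeff (f g : NCSeries k) (w : List (Fin k)) :
    (f * g) w = ∑ p ∈ Finset.range (w.length + 1), f (w.take p) * g (w.drop p) := rfl

theorem mul_nil (f g : NCSeries k) : (f * g) [] = f [] * g [] := by
  simp [mul_coeff]

/-- Multiplication of all coefficients by an integer. -/
def scale (c : ℤ) (f : NCSeries k) : NCSeries k := fun w => c * f w

/-- The series of the coefficients of the monomials that begin with `a`, with `a` removed. -/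
def tail (a : Fin k) (f : NCSeries k) : NCSeries k := fun w => f (a :: w)

theorem mul_cons (f g : NCSeries k) (a : Fin k) (w : List (Fin k)) :
    (f * g) (a :: w) = f [] * g (a :: w) + (tail a f * g) w := by
  rw [mul_coeff, mul_coeff, List.length_cons, Finset.sum_range_succ']
  simp [tail, add_comm]

theorem left_distrib' (f g h : NCSeries k) : f * (g + h) = f * g + f * h := by
  ext w
  simp only [add_coeff, mul_coeff, mul_add, Finset.sum_add_distrib]

theorem right_distrib' (f g h : NCSeries k) : (f + g) * h = f * h + g * h := by
  ext w
  simp only [add_coeff, mul_coeff, add_mul, Finset.sum_add_distrib]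

theorem zero_mul' (f : NCSeries k) : 0 * f = 0 := by
  ext w
  simp [mul_coeff, zero_coeff]

theorem mul_zero' (f : NCSeries k) : f * 0 = 0 := by
  ext w
  simp [mul_coeff, zero_coeff]

theorem one_mul' (f : NCSeries k) : 1 * f = f := by
  ext w
  cases w with
  | nil => simp [mul_nil, one_coeff]
  | cons a w =>
    have h : tail a (1 : NCSeries k) = 0 := by ext v; simp [tail, one_coeff, zero_coeff]
    rw [mul_cons, h, zero_mul', zero_coeff, one_coeff]
    simp

theorem mul_one' (f : NCSeries k) : f * 1 = f := by
  ext w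
  induction w generalizing f with
  | nil => simp [mul_nil, one_coeff]
  | cons a w ih => rw [mul_cons, ih, one_coeff]; simp [tail]

theorem mul_assoc' (f g h : NCSeries k) : f * g * h = f * (g * h) := by
  ext w
  induction w generalizing f with
  | nil => simp [mul_nil, mul_assoc]
  | cons a w ih =>
    have h1 : tail a (f * g) = scale (f []) (tail a g) + tail a f * g := by
      ext v
      rw [add_coeff, tail, mul_cons]
      rfl
    have h2 : (scale (f []) (tail a g) * h) w = f [] * (tail a g * h) w := by
      simp only [mul_coeff, scale, Finset.mul_sum, mul_assoc]
    rw [mul_cons, h1, right_distrib', add_coeff, h2, ih, mul_cons f, mul_cons g, mul_nil]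
    ring

instance : Ring (NCSeries k) where
  __ := instAddCommGroup
  left_distrib := left_distrib'
  right_distrib := right_distrib'
  zero_mul := zero_mul'
  mul_zero := mul_zero'
  mul_assoc := mul_assoc'
  one_mul := one_mul'
  mul_one := mul_one'

/-- The variable `X i`. -/
def X (i : Fin k) : NCSeries k := fun w => if w = [i] then 1 else 0

/-- The series `1 - X i + (X i)² - (X i)³ + ⋯`. -/
def altGeom (i : Fin k) : NCSeries k :=
  fun w => if w = List.replicate w.length i then (-1) ^ w.length else 0

theorem altGeom_cons (i a : Fin k) (w : List (Fin k)) :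
    altGeom i (a :: w) = if a = i then - altGeom i w else 0 := by
  by_cases h : a = i
  · by_cases hw : w = List.replicate w.length i
    · rw [if_pos h, altGeom, altGeom, if_pos hw, if_pos, List.length_cons, pow_succ]
      · ring
      · rw [List.length_cons, List.replicate_succ, ← hw, h]
    · rw [if_pos h, altGeom, altGeom, if_neg hw, if_neg, neg_zero]
      rw [List.length_cons, List.replicate_succ, List.cons.injEq]
      exact fun h' => hw h'.2
  · rw [if_neg h, altGeom, if_neg]
    rw [List.length_cons, List.replicate_succ, List.cons.injEq]
    exact fun h' => h h'.1

theorem tail_X (i a : Fin k) : tail a (X i) = if a = i then 1 else 0 := by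
  ext w
  by_cases h : a = i
  · rw [if_pos h]; simp [tail, X, one_coeff, h]
  · rw [if_neg h]; simp [tail, X, zero_coeff, h]

theorem X_nil (i : Fin k) : X i [] = 0 := by simp [X]

theorem one_add_X_mul_altGeom (i : Fin k) : (1 + X i) * altGeom i = 1 := by
  rw [add_mul, one_mul]
  ext w
  cases w with
  | nil => simp [add_coeff, mul_nil, X_nil, altGeom, one_coeff]
  | cons a w =>
    rw [add_coeff, mul_cons, tail_X, X_nil, altGeom_cons, one_coeff]
    by_cases h : a = i <;> simp [h, zero_coeff]

theorem altGeom_mul_one_add_X (i : Fin k) : altGeom i * (1 + X i) = 1 := by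
  rw [mul_add, mul_one]
  have tail_alt : ∀ a, tail a (altGeom i) = if a = i then - altGeom i else 0 := by
    intro a
    ext w
    rw [tail, altGeom_cons]
    by_cases h : a = i
    · simp only [h, if_true]; rfl
    · simp [h, zero_coeff]
  have key : ∀ w : List (Fin k), (altGeom i + altGeom i * X i) w = (1 : NCSeries k) w := by
    intro w
    induction w with
    | nil => simp [add_coeff, mul_nil, X_nil, altGeom, one_coeff]
    | cons a w ih =>
      rw [add_coeff, mul_cons, tail_alt, altGeom_cons, one_coeff]
      by_cases h : a = i
      · have h3 : (-altGeom i * X i) w = -((altGeom i * X i) w) := by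
          rw [neg_mul]; rfl
        rw [add_coeff, one_coeff] at ih
        have h0 : altGeom i [] = 1 := by simp [altGeom]
        simp only [h, if_true, h3, h0]
        cases w <;> simp_all [X] <;> linarith
      · simp [h, zero_coeff, X]
  exact ext key

/-- The unit `1 + X i`, with inverse `1 - X i + (X i)² - ⋯`. -/
def unitOneAddX (i : Fin k) : (NCSeries k)ˣ where
  val := 1 + X i
  inv := altGeom i
  val_inv := one_add_X_mul_altGeom i
  inv_val := altGeom_mul_one_add_X i

/-- The ordering of series: compare the coefficients of the first monomial at which the two series
differ, where monomials are listed by degree and, within each degree, lexicographically. -/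
def Lt (f g : NCSeries k) : Prop :=
  ∃ w : List (Fin k), (∀ v, List.Shortlex (· < ·) v w → f v = g v) ∧ f w < g w

end NCSeries

/-- The Magnus expansion of the free group on `k` generators, `x i ↦ 1 + X i`. -/
def magnus (k : ℕ) : FreeGroup (Fin k) →* (NCSeries k)ˣ :=
  FreeGroup.lift NCSeries.unitOneAddX

/-- The Magnus ordering of the free group on `k` generators. -/
def MagnusLt {k : ℕ} (u v : FreeGroup (Fin k)) : Prop :=
  NCSeries.Lt (magnus k u : NCSeries k) (magnus k v : NCSeries k)

/-! ### The ordering of pure braids and bi-orderings -/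

/-- The Kim–Rolfsen ordering: compare Artin coordinates lexicographically, using the Magnus
ordering on each free factor. -/
def KimRolfsenLt {n : ℕ} (α β : PureBraidGroup n) : Prop :=
  ∃ u v : (k : Fin (n - 1)) → FreeGroup (Fin ((k : ℕ) + 1)),
    IsArtinCoordinates α u ∧ IsArtinCoordinates β v ∧
    ∃ k, (∀ j < k, u j = v j) ∧ MagnusLt (u k) (v k)

/-- A bi-ordering of a group: a strict total ordering invariant under multiplication on both
sides. -/
structure IsBiOrdering {G : Type*} [Group G] (lt : G → G → Prop) : Prop where
  isStrictTotalOrder : IsStrictTotalOrder G lt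
  mul_right : ∀ x y z : G, lt x y → lt (x * z) (y * z)
  mul_left : ∀ x y z : G, lt x y → lt (z * x) (z * y)

/-!
The pure braid group is an iterated semidirect product of free groups (Artin's combing), and the
free factors carry orderings that all the actions involved preserve; the ordering of the pure
braids is the resulting lexicographic one.

*Magnus ordering.* The Magnus expansion is injective (`magnus_injective`): a product of syllables
`x i ^ e` has the product of the exponents as its coefficient at the word of the `i`s. The
comparison of two elements depends only on the lowest degree part of the difference of their
series (`NCSeries.Lt.of_sub_eqBelow`). This part is unchanged by multiplication on either side
with a series with constant term `1`, and also by a substitution `X a ↦ X a + (terms of higher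
degree)`. The second fact shows that endomorphisms which are trivial on the abelianization
preserve the ordering (`MagnusLt.map`).

*Combing.* Every braid on the strands `0, …, k + 1` is a product `b * u * desc j`, in which `b`
does not involve the strand `k + 1`, `u` lies in the free factor of that strand and `desc j` is
one of `k + 2` coset representatives (`BraidGroup.exists_normalForm`). This follows by multiplying
with one generator at a time, since a generator conjugates the free factor by one of Artin's
automorphisms (`BraidGroup.gen_conj_freeFactor`). For a pure braid `desc j = 1`, and induction on
`k` gives existence of the coordinates. For uniqueness, the same formulas define an action of the
braid group on pairs of a word in a free group and a position (`BraidGroup.cosetAction`), and the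
last coordinate is read off from the image of a base point
(`BraidGroup.cosetAction_partialProd_inv`).

*Invariance.* In coordinates, `(α β)_k` is the product of `α_k`, acted on by the lower coordinates
of `β`, and `β_k` (`BraidGroup.exists_coords_mul`). A pure braid acts on the abelianization of a
free factor trivially, so it preserves the Magnus ordering there, and the lexicographic ordering
is invariant on both sides.

*Positive braids.* If the braid in a normal form is positive, then so is `b`, and the exponent
sums of `u`, which are linking numbers, are nonnegative (`BraidGroup.exists_normalForm_of_pos`).
The word length of a positive pure braid is twice the sum of all its exponent sums. Hence the
exponent sums of the first non-trivial coordinate do not all vanish, and their first nonzero one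
is positive, which decides the comparison with the identity. For well-foundedness, fix the lower
coordinates: the exponent sums of the next coordinate are a vector of natural numbers, and these
are well-ordered lexicographically; once the vector is fixed too, the word length is fixed and
only finitely many braids remain (`BraidGroup.wellFoundedOn_coordsLt`).
-/

/-! ### Truncated equality and substitution in power series -/

namespace NCSeries

variable {k : ℕ}

/-- Congruence of series modulo the terms of degree at least `n`. -/
def EqBelow (n : ℕ) (f g : NCSeries k) : Prop := ∀ w : List (Fin k), w.length < n → f w = g w

theorem sub_coeff (f g : NCSeries k) (w : List (Fin k)) : (f - g) w = f w - g w := rfl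

theorem zsmul_coeff (c : ℤ) (f : NCSeries k) (w : List (Fin k)) : (c • f) w = c * f w := by
  change c • f w = _
  rw [smul_eq_mul]

theorem sum_coeff {ι : Type*} (s : Finset ι) (f : ι → NCSeries k) (w : List (Fin k)) :
    (∑ i ∈ s, f i) w = ∑ i ∈ s, f i w := by
  classical
  induction s using Finset.induction_on with
  | empty => simp [zero_coeff]
  | insert a s ha ih => rw [Finset.sum_insert ha, Finset.sum_insert ha, add_coeff, ih]

theorem tail_mul (a : Fin k) (f g : NCSeries k) :
    tail a (f * g) = f [] • tail a g + tail a f * g := by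
  ext w
  rw [add_coeff, zsmul_coeff, tail, mul_cons]
  rfl

/-- A series is its constant term plus the sum of its parts beginning with a given variable. -/
theorem eq_const_add_sum_X_mul_tail (f : NCSeries k) :
    f = f [] • 1 + ∑ a, X a * tail a f := by
  ext w
  rw [add_coeff, zsmul_coeff, one_coeff, sum_coeff]
  cases w with
  | nil => simp [mul_nil, X_nil]
  | cons b w =>
    simp only [mul_cons, X_nil, tail_X]
    rw [Finset.sum_eq_single b]
    · simp [tail]
    · intro a _ h
      rw [if_neg h.symm]
      simp [zero_coeff]
    · simp

namespace EqBelow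

variable {n m : ℕ} {f g h f' g' : NCSeries k}

theorem rfl' : EqBelow n f f := fun _ _ => rfl

theorem symm (H : EqBelow n f g) : EqBelow n g f := fun w hw => (H w hw).symm

theorem trans (H : EqBelow n f g) (H' : EqBelow n g h) : EqBelow n f h :=
  fun w hw => (H w hw).trans (H' w hw)

theorem mono (H : EqBelow n f g) (hm : m ≤ n) : EqBelow m f g :=
  fun w hw => H w (hw.trans_le hm)

theorem zero : EqBelow 0 f g := fun _ hw => absurd hw (Nat.not_lt_zero _)

theorem add (H : EqBelow n f g) (H' : EqBelow n f' g') : EqBelow n (f + f') (g + g') :=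
  fun w hw => by rw [add_coeff, add_coeff, H w hw, H' w hw]

theorem sum {ι : Type*} {s : Finset ι} {F G : ι → NCSeries k}
    (H : ∀ i ∈ s, EqBelow n (F i) (G i)) : EqBelow n (∑ i ∈ s, F i) (∑ i ∈ s, G i) :=
  fun w hw => by
    rw [sum_coeff, sum_coeff]
    exact Finset.sum_congr rfl fun i hi => H i hi w hw

/-- Multiplication by a series without constant term gains one degree of precision. -/
theorem mul_of_nil {y : NCSeries k} (hy : y [] = 0) (H : EqBelow n f g) :
    EqBelow (n + 1) (y * f) (y * g) := fun w hw => by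
  rw [mul_coeff, mul_coeff]
  refine Finset.sum_congr rfl fun p hp => ?_
  rw [Finset.mem_range] at hp
  rcases Nat.eq_zero_or_pos p with rfl | hp0
  · simp [hy]
  · rw [H _ (by rw [List.length_drop]; omega)]

/-- A congruence between factors gains `n` degrees of precision in a product with a series
without terms of degree less than `n`. -/
theorem mul_of_eqBelow_zero {y z : NCSeries k} (H : EqBelow (m + 1) y z) (hf : EqBelow n f 0) :
    EqBelow (n + m + 1) (y * f) (z * f) := fun w hw => by
  rw [mul_coeff, mul_coeff]
  refine Finset.sum_congr rfl fun p hp => ?_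
  rw [Finset.mem_range] at hp
  by_cases h : p < m + 1
  · rw [H _ ((List.length_take_le p w).trans_lt h)]
  · rw [hf _ (by rw [List.length_drop]; omega), zero_coeff, mul_zero, mul_zero]

theorem eq (H : ∀ n, EqBelow n f g) : f = g := ext fun w => H (w.length + 1) w (Nat.lt_succ_self _)

end EqBelow

/-- The substitution of `y a` for the variable `X a`, computed correctly in degrees below the
first argument. -/
def substAux (y : Fin k → NCSeries k) : ℕ → NCSeries k → NCSeries k
  | 0, _ => 0
  | n + 1, f => f [] • 1 + ∑ a, y a * substAux y n (tail a f)

theorem substAux_succ_eqBelow {y : Fin k → NCSeries k} (hy : ∀ a, y a [] = 0) (n : ℕ)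
    (f : NCSeries k) : EqBelow n (substAux y n f) (substAux y (n + 1) f) := by
  induction n generalizing f with
  | zero => exact EqBelow.zero
  | succ n ih => exact EqBelow.rfl'.add (EqBelow.sum fun a _ => (ih _).mul_of_nil (hy a))

theorem substAux_eqBelow {y : Fin k → NCSeries k} (hy : ∀ a, y a [] = 0) {n m : ℕ} (h : n ≤ m)
    (f : NCSeries k) : EqBelow n (substAux y n f) (substAux y m f) := by
  induction m, h using Nat.le_induction with
  | base => exact EqBelow.rfl'
  | succ m hm ih => exact ih.trans ((substAux_succ_eqBelow hy m f).mono hm)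

/-- The series obtained from `f` by substituting `y a` for the variable `X a`; meaningful if no
`y a` has a constant term. -/
def subst (y : Fin k → NCSeries k) (f : NCSeries k) : NCSeries k :=
  fun w => substAux y (w.length + 1) f w

theorem subst_eqBelow {y : Fin k → NCSeries k} (hy : ∀ a, y a [] = 0) (n : ℕ) (f : NCSeries k) :
    EqBelow n (subst y f) (substAux y n f) := fun w hw =>
  substAux_eqBelow hy (Nat.succ_le_of_lt hw) f w (Nat.lt_succ_self _)

theorem subst_eq {y : Fin k → NCSeries k} (hy : ∀ a, y a [] = 0) (f : NCSeries k) :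
    subst y f = f [] • 1 + ∑ a, y a * subst y (tail a f) :=
  EqBelow.eq fun n => ((subst_eqBelow hy (n + 1) f).trans
    (EqBelow.rfl'.add (EqBelow.sum fun a _ =>
      (subst_eqBelow hy n (tail a f)).symm.mul_of_nil (hy a)))).mono n.le_succ

theorem subst_add {y : Fin k → NCSeries k} (hy : ∀ a, y a [] = 0) (f g : NCSeries k) :
    subst y (f + g) = subst y f + subst y g := by
  refine EqBelow.eq fun n => ?_
  induction n generalizing f g with
  | zero => exact EqBelow.zero
  | succ n ih =>
    have h : subst y f + subst y g =
        (f + g) [] • 1 + ∑ a, y a * (subst y (tail a f) + subst y (tail a g)) := by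
      rw [subst_eq hy f, subst_eq hy g, add_coeff, add_smul]
      simp only [mul_add, Finset.sum_add_distrib]
      abel
    rw [h, subst_eq hy (f + g)]
    exact EqBelow.rfl'.add (EqBelow.sum fun a _ => (ih _ _).mul_of_nil (hy a))

/-- Substitution as an additive homomorphism. -/
def substAddHom (y : Fin k → NCSeries k) (hy : ∀ a, y a [] = 0) : NCSeries k →+ NCSeries k :=
  AddMonoidHom.mk' (subst y) (subst_add hy)

theorem subst_sub {y : Fin k → NCSeries k} (hy : ∀ a, y a [] = 0) (f g : NCSeries k) :
    subst y (f - g) = subst y f - subst y g := map_sub (substAddHom y hy) f g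

theorem subst_zsmul {y : Fin k → NCSeries k} (hy : ∀ a, y a [] = 0) (c : ℤ) (f : NCSeries k) :
    subst y (c • f) = c • subst y f := map_zsmul (substAddHom y hy) c f

theorem subst_zero {y : Fin k → NCSeries k} (hy : ∀ a, y a [] = 0) : subst y 0 = 0 :=
  map_zero (substAddHom y hy)

/-- Substitution is multiplicative, by induction on the degree: splitting off the first letter
reduces the degree by one, since no `y a` has a constant term. -/
theorem subst_mul {y : Fin k → NCSeries k} (hy : ∀ a, y a [] = 0) (f g : NCSeries k) :
    subst y (f * g) = subst y f * subst y g := by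
  refine EqBelow.eq fun n => ?_
  induction n generalizing f g with
  | zero => exact EqBelow.zero
  | succ n ih =>
    have h1 : subst y (f * g) =
        f [] • subst y g + ∑ a, y a * subst y (tail a f * g) := by
      rw [subst_eq hy (f * g), subst_eq hy g]
      simp only [tail_mul, subst_add hy, subst_zsmul hy, mul_add, Finset.sum_add_distrib, mul_nil,
        smul_add, Finset.smul_sum, mul_smul_comm, mul_smul]
      abel
    have h2 : subst y f * subst y g =
        f [] • subst y g + ∑ a, y a * (subst y (tail a f) * subst y g) := by
      conv_lhs => rw [subst_eq hy f]
      simp only [add_mul, Finset.sum_mul, smul_mul_assoc, one_mul, mul_assoc]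
    rw [h1, h2]
    exact EqBelow.rfl'.add (EqBelow.sum fun a _ => (ih _ _).mul_of_nil (hy a))

theorem tail_one (a : Fin k) : tail a (1 : NCSeries k) = 0 := by
  ext w
  simp [tail, one_coeff, zero_coeff]

theorem subst_one {y : Fin k → NCSeries k} (hy : ∀ a, y a [] = 0) : subst y 1 = 1 := by
  rw [subst_eq hy]
  simp [tail_one, subst_zero hy, one_coeff]

theorem subst_X {y : Fin k → NCSeries k} (hy : ∀ a, y a [] = 0) (a : Fin k) :
    subst y (X a) = y a := by
  rw [subst_eq hy, X_nil, zero_smul, zero_add, Finset.sum_eq_single a]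
  · rw [tail_X, if_pos rfl, subst_one hy, mul_one]
  · intro b _ hb
    rw [tail_X, if_neg hb, subst_zero hy, mul_zero]
  · simp

/-- Substitution as a homomorphism of multiplicative monoids. -/
def substHom (y : Fin k → NCSeries k) (hy : ∀ a, y a [] = 0) : NCSeries k →* NCSeries k where
  toFun := subst y
  map_one' := subst_one hy
  map_mul' := subst_mul hy

/-- A substitution that is the identity in degree one does not change the terms of lowest
degree. -/
theorem subst_eqBelow_self {y : Fin k → NCSeries k} (hy : ∀ a, EqBelow 2 (y a) (X a)) {n : ℕ}
    {f : NCSeries k} (hf : EqBelow n f 0) : EqBelow (n + 1) (subst y f) f := by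
  have hy0 : ∀ a, y a [] = 0 := fun a => by rw [hy a [] (by simp), X_nil]
  induction n generalizing f with
  | zero =>
    intro w hw
    obtain rfl : w = [] := List.eq_nil_of_length_eq_zero (by omega)
    rw [subst_eq hy0, add_coeff, sum_coeff, zsmul_coeff, one_coeff]
    simp [mul_nil, hy0]
  | succ n ih =>
    rw [subst_eq hy0]
    conv => arg 3; rw [eq_const_add_sum_X_mul_tail f]
    have ht : ∀ a, EqBelow n (tail a f) 0 := fun a w hw => hf (a :: w) (by simpa using hw)
    exact EqBelow.rfl'.add (EqBelow.sum fun a _ =>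
      ((ih (ht a)).mul_of_nil (hy0 a)).trans ((hy a).mul_of_eqBelow_zero (ht a)))

/-! ### The ordering of power series -/

theorem Lt.irrefl (f : NCSeries k) : ¬ Lt f f := fun ⟨_, _, h⟩ => lt_irrefl _ h

theorem shortlex_trans {u v w : List (Fin k)} (h : List.Shortlex (· < ·) u v)
    (h' : List.Shortlex (· < ·) v w) : List.Shortlex (· < ·) u w := by
  rw [List.shortlex_def] at *
  rcases h with h | ⟨h, h1⟩ <;> rcases h' with h' | ⟨h', h2⟩
  · exact Or.inl (h.trans h')
  · exact Or.inl (h.trans_eq h')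
  · exact Or.inl (h.trans_lt h')
  · exact Or.inr ⟨h.trans h', List.lt_trans (α := Fin k) h1 h2⟩

theorem Lt.trans {f g h : NCSeries k} : Lt f g → Lt g h → Lt f h := by
  rintro ⟨u, hu, hu'⟩ ⟨v, hv, hv'⟩
  rcases trichotomous_of (List.Shortlex (· < ·)) u v with huv | rfl | hvu
  · exact ⟨u, fun w hw => (hu w hw).trans (hv w (shortlex_trans hw huv)), by rwa [← hv u huv]⟩
  · exact ⟨u, fun w hw => (hu w hw).trans (hv w hw), hu'.trans hv'⟩
  · exact ⟨v, fun w hw => (hu w (shortlex_trans hw hvu)).trans (hv w hw), by rwa [hu v hvu]⟩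

theorem Lt.trichotomy (f g : NCSeries k) : Lt f g ∨ f = g ∨ Lt g f := by
  by_cases h : f = g
  · exact Or.inr (Or.inl h)
  · obtain ⟨w, hw, hmin⟩ := (List.Shortlex.wf (r := ((· < ·) : Fin k → Fin k → Prop))
      wellFounded_lt).has_min {w | f w ≠ g w} (Function.ne_iff.1 h)
    have heq : ∀ v, List.Shortlex (· < ·) v w → f v = g v := fun v hv => by
      by_contra hne
      exact hmin v hne hv
    rcases lt_or_gt_of_ne hw with hlt | hlt
    · exact Or.inl ⟨w, heq, hlt⟩
    · exact Or.inr (Or.inr ⟨w, fun v hv => (heq v hv).symm, hlt⟩)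

/-- The ordering of series depends only on the lowest degree terms of the difference. -/
theorem Lt.of_sub_eqBelow {f g f' g' : NCSeries k} (h : Lt f g)
    (H : ∀ n, EqBelow n (g - f) 0 → EqBelow (n + 1) (g' - f') (g - f)) : Lt f' g' := by
  obtain ⟨w, hw, hlt⟩ := h
  have hH := H w.length fun v hv => by
    rw [sub_coeff, hw v (List.Shortlex.of_length_lt hv), sub_self, zero_coeff]
  refine ⟨w, fun v hv => ?_, ?_⟩
  · have hlen : v.length < w.length + 1 := by
      rw [List.shortlex_def] at hv
      omega
    have := hH v hlen
    rw [sub_coeff, sub_coeff, hw v hv] at this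
    linarith
  · have := hH w (Nat.lt_succ_self _)
    rw [sub_coeff, sub_coeff] at this
    linarith

theorem Lt.mul_right {f g h : NCSeries k} (hh : h [] = 1) (H : Lt f g) : Lt (f * h) (g * h) := by
  refine H.of_sub_eqBelow fun n hn w hw => ?_
  rw [← sub_mul, mul_coeff, Finset.sum_range_succ, Finset.sum_eq_zero, zero_add]
  · simp [hh]
  · intro p hp
    rw [hn _ (by rw [Finset.mem_range] at hp; rw [List.length_take]; omega), zero_coeff, zero_mul]

theorem Lt.mul_left {f g h : NCSeries k} (hh : h [] = 1) (H : Lt f g) : Lt (h * f) (h * g) := by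
  refine H.of_sub_eqBelow fun n hn w hw => ?_
  rw [← mul_sub, mul_coeff, Finset.sum_range_succ', Finset.sum_eq_zero, zero_add]
  · simp [hh]
  · intro p hp
    rw [hn _ (by rw [Finset.mem_range] at hp; rw [List.length_drop]; omega), zero_coeff, mul_zero]

theorem Lt.subst {f g : NCSeries k} {y : Fin k → NCSeries k}
    (hy : ∀ a, EqBelow 2 (y a) (X a)) (H : Lt f g) : Lt (subst y f) (NCSeries.subst y g) := by
  refine H.of_sub_eqBelow fun n hn => ?_
  rw [← subst_sub fun a => by rw [hy a [] (by simp), X_nil]]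
  exact subst_eqBelow_self hy hn

end NCSeries

/-! ### The Magnus expansion -/

section Magnus

open NCSeries

variable {k : ℕ}

theorem magnus_of (a : Fin k) : (magnus k (FreeGroup.of a) : NCSeries k) = 1 + X a := by
  simp [magnus, unitOneAddX]

theorem magnus_nil (u : FreeGroup (Fin k)) : (magnus k u : NCSeries k) [] = 1 := by
  induction u using FreeGroup.induction_on with
  | C1 => simp [one_coeff]
  | of a =>
    rw [magnus_of, add_coeff, X_nil, one_coeff, if_pos rfl, add_zero]
  | inv_of a h =>
    have := congrArg (fun f : NCSeries k => f []) (magnus k (FreeGroup.of a)).mul_inv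
    simpa [mul_nil, h, one_coeff] using this
  | mul x y hx hy => rw [map_mul, Units.val_mul, mul_nil, hx, hy, one_mul]

/-- The exponent sum of the generator `a` in `u`, read off as the coefficient of `X a` in the
Magnus expansion. -/
def expSum (u : FreeGroup (Fin k)) (a : Fin k) : ℤ := (magnus k u : NCSeries k) [a]

theorem expSum_one (a : Fin k) : expSum (1 : FreeGroup (Fin k)) a = 0 := by
  simp [expSum, one_coeff]

theorem expSum_mul (u v : FreeGroup (Fin k)) (a : Fin k) :
    expSum (u * v) a = expSum u a + expSum v a := by
  simp [expSum, mul_coeff, Finset.sum_range_succ, magnus_nil, add_comm]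

theorem expSum_inv (u : FreeGroup (Fin k)) (a : Fin k) : expSum u⁻¹ a = - expSum u a := by
  have := expSum_mul u u⁻¹ a
  rw [mul_inv_cancel, expSum_one] at this
  linarith

theorem expSum_of (a b : Fin k) : expSum (FreeGroup.of a) b = if b = a then 1 else 0 := by
  rw [expSum, magnus_of, add_coeff, one_coeff]
  simp [X]

theorem MagnusLt.mul_right {u v : FreeGroup (Fin k)} (h : MagnusLt u v) (w : FreeGroup (Fin k)) :
    MagnusLt (u * w) (v * w) := by
  simpa [MagnusLt] using Lt.mul_right (magnus_nil w) h

theorem MagnusLt.mul_left {u v : FreeGroup (Fin k)} (h : MagnusLt u v) (w : FreeGroup (Fin k)) :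
    MagnusLt (w * u) (w * v) := by
  simpa [MagnusLt] using Lt.mul_left (magnus_nil w) h

/-- An endomorphism that is trivial on the abelianization preserves the Magnus ordering: on
Magnus expansions it acts by a substitution that is the identity in degree one. -/
theorem MagnusLt.map {θ : FreeGroup (Fin k) →* FreeGroup (Fin k)}
    (hθ : ∀ u a, expSum (θ u) a = expSum u a) {u v : FreeGroup (Fin k)} (h : MagnusLt u v) :
    MagnusLt (θ u) (θ v) := by
  let y : Fin k → NCSeries k := fun a => magnus k (θ (FreeGroup.of a)) - 1
  have hy : ∀ a, EqBelow 2 (y a) (X a) := by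
    intro a w hw
    match w, hw with
    | [], _ => simp [y, sub_coeff, magnus_nil, one_coeff, X_nil]
    | [b], _ =>
      have := hθ (FreeGroup.of a) b
      rw [expSum_of, expSum] at this
      simp [y, sub_coeff, this, one_coeff, X]
  have hy0 : ∀ a, y a [] = 0 := fun a => by rw [hy a [] (by simp), X_nil]
  have key : (magnus k).comp θ = (Units.map (substHom y hy0)).comp (magnus k) := by
    ext1 a
    refine Units.ext ?_
    change (magnus k (θ (FreeGroup.of a)) : NCSeries k) =
      NCSeries.subst y (magnus k (FreeGroup.of a) : NCSeries k)
    rw [magnus_of, subst_add hy0, subst_one hy0, subst_X hy0]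
    simp [y]
  have key' : ∀ u, (magnus k (θ u) : NCSeries k) =
      NCSeries.subst y (magnus k u : NCSeries k) := fun u =>
    congrArg Units.val (DFunLike.congr_fun key u)
  rw [MagnusLt, key', key']
  exact Lt.subst hy h

/-- Multiplication by `(1 + X i) ^ e`, seen in words in which the letter `i` is not repeated at
the beginning. -/
theorem unitOneAddX_zpow_mul (i : Fin k) (e : ℤ) (f : NCSeries k) (w : List (Fin k))
    (hw : w.head? ≠ some i) :
    (((unitOneAddX i ^ e : (NCSeries k)ˣ) : NCSeries k) * f) w = f w ∧
      (((unitOneAddX i ^ e : (NCSeries k)ˣ) : NCSeries k) * f) (i :: w) = f (i :: w) + e * f w := by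
  have base : ∀ f : NCSeries k, ((unitOneAddX i : NCSeries k) * f) w = f w ∧
      ((unitOneAddX i : NCSeries k) * f) (i :: w) = f (i :: w) + f w := by
    intro f
    change ((1 + X i) * f) w = _ ∧ ((1 + X i) * f) (i :: w) = _
    rw [add_mul, one_mul, add_coeff, add_coeff, mul_cons, X_nil, tail_X, if_pos rfl, one_mul]
    refine ⟨?_, by ring⟩
    cases w with
    | nil => simp [mul_nil, X_nil]
    | cons b w =>
      rw [mul_cons, X_nil, tail_X, if_neg (by simpa using hw)]
      simp [zero_coeff]
  induction e generalizing f with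
  | zero => simp
  | succ e ih =>
    rw [zpow_add_one, Units.val_mul, mul_assoc, (ih _).1, (ih _).2, (base f).1, (base f).2]
    refine ⟨rfl, ?_⟩
    ring
  | pred e ih =>
    rw [zpow_sub_one, Units.val_mul, mul_assoc, (ih _).1, (ih _).2]
    have h := base (((unitOneAddX i)⁻¹ : (NCSeries k)ˣ) * f)
    rw [Units.mul_inv_cancel_left] at h
    rw [← h.1]
    refine ⟨rfl, ?_⟩
    have h2 := h.2
    linarith

/-- The Magnus expansion of a product of syllables `x i ^ e` with all `e ≠ 0` and adjacent `i`
distinct: the coefficient of the word of the `i`s is the product of the exponents, and no longer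
word without repeated adjacent letters occurs. -/
theorem prod_unitOneAddX_zpow (L : List (Fin k × ℤ)) (hL : ∀ l ∈ L, l.2 ≠ 0)
    (hc : L.IsChain fun l l' => l.1 ≠ l'.1) :
    (∀ w : List (Fin k), w.IsChain (· ≠ ·) → L.length < w.length →
      ((L.map fun l => unitOneAddX l.1 ^ l.2).prod : NCSeries k) w = 0) ∧
    ((L.map fun l => unitOneAddX l.1 ^ l.2).prod : NCSeries k) (L.map Prod.fst) ≠ 0 := by
  induction L with
  | nil =>
    refine ⟨fun w _ hw => ?_, by simp [one_coeff]⟩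
    rw [List.map_nil, List.prod_nil, Units.val_one, one_coeff, if_neg]
    rintro rfl
    simp at hw
  | cons l L ih =>
    obtain ⟨h1, h2⟩ := ih (fun l hl => hL l (List.mem_cons_of_mem _ hl)) hc.tail
    have hhead : ∀ {w : List (Fin k)} {a : Fin k}, (a :: w).IsChain (· ≠ ·) →
        w.head? ≠ some a := by
      intro w a hw
      cases w with
      | nil => simp
      | cons b w =>
        rw [List.isChain_cons_cons] at hw
        simpa using hw.1.symm
    have hchain : (List.map Prod.fst (l :: L)).IsChain (· ≠ ·) := List.isChain_map _ |>.2 hc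
    rw [List.map_cons, List.prod_cons, Units.val_mul]
    refine ⟨fun w hw hlen => ?_, ?_⟩
    · match w, hw, hlen with
      | a :: w, hw, hlen =>
        have hlen' : L.length < w.length := by simpa using hlen
        have hz := h1 (a :: w) hw (by rw [List.length_cons]; omega)
        by_cases ha : a = l.1
        · subst ha
          rw [(unitOneAddX_zpow_mul l.1 l.2 _ w (hhead hw)).2, hz, h1 w hw.tail hlen']
          simp
        · rw [(unitOneAddX_zpow_mul l.1 l.2 _ (a :: w) (by simpa using ha)).1, hz]
    · rw [List.map_cons] at hchain ⊢
      rw [(unitOneAddX_zpow_mul l.1 l.2 _ _ (hhead hchain)).2,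
        h1 _ hchain (by simp), zero_add]
      exact mul_ne_zero (by exact_mod_cast hL l List.mem_cons_self) h2

/-- Magnus's theorem, via the decomposition of an element of the free group into syllables. -/
theorem magnus_injective (k : ℕ) : Function.Injective (magnus k) := by
  classical
  rw [injective_iff_map_eq_one]
  intro u hu
  let E : FreeGroup Unit ≃ ℤ := FreeGroup.freeGroupUnitEquivInt
  have hE : ∀ g, FreeGroup.of () ^ E g = g := E.left_inv
  have hlift : magnus k = (Monoid.CoprodI.lift fun i : Fin k =>
      FreeGroup.lift fun _ : Unit => unitOneAddX i).comp
        (freeGroupEquivCoprodI (ι := Fin k)).toMonoidHom := by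
    ext1 i
    simp [magnus]
  let W := Monoid.CoprodI.Word.equiv (freeGroupEquivCoprodI u)
  have hW : W.prod = freeGroupEquivCoprodI u := Monoid.CoprodI.Word.equiv.symm_apply_apply _
  let L : List (Fin k × ℤ) := W.toList.map fun l => (l.1, E l.2)
  have hprod : magnus k u = (L.map fun l => unitOneAddX l.1 ^ l.2).prod := by
    rw [hlift, MonoidHom.comp_apply]
    change Monoid.CoprodI.lift _ (freeGroupEquivCoprodI u) = _
    rw [← hW, Monoid.CoprodI.Word.prod, map_list_prod, List.map_map, List.map_map]
    congr 1
    refine List.map_congr_left fun l _ => ?_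
    simp only [Function.comp_apply, Monoid.CoprodI.lift_of]
    conv_lhs => rw [← hE l.2]
    rw [map_zpow, FreeGroup.lift_apply_of]
  have hne : ∀ l ∈ L, l.2 ≠ 0 := by
    intro l hl
    obtain ⟨m, hm, rfl⟩ := List.mem_map.1 hl
    intro h0
    apply W.ne_one m hm
    rw [← hE m.2, show E m.2 = 0 from h0, zpow_zero]
  have hch : L.IsChain fun l l' => l.1 ≠ l'.1 := List.isChain_map _ |>.2 W.chain_ne
  have h := (prod_unitOneAddX_zpow L hne hch).2
  rw [← hprod, hu, Units.val_one, one_coeff] at h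
  have hLnil : L.map Prod.fst = [] := by
    by_contra h'
    exact h (if_neg h')
  have hWnil : W.toList = [] := by simpa [L] using hLnil
  apply (freeGroupEquivCoprodI (ι := Fin k)).injective
  rw [map_one, ← hW, Monoid.CoprodI.Word.prod, hWnil, List.map_nil, List.prod_nil]

theorem MagnusLt.irrefl (u : FreeGroup (Fin k)) : ¬ MagnusLt u u := Lt.irrefl _

theorem MagnusLt.trans {u v w : FreeGroup (Fin k)} : MagnusLt u v → MagnusLt v w → MagnusLt u w :=
  Lt.trans

theorem MagnusLt.trichotomy (u v : FreeGroup (Fin k)) : MagnusLt u v ∨ u = v ∨ MagnusLt v u := by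
  rcases Lt.trichotomy (magnus k u : NCSeries k) (magnus k v) with h | h | h
  · exact Or.inl h
  · exact Or.inr (Or.inl (magnus_injective k (Units.ext h)))
  · exact Or.inr (Or.inr h)

/-- The Magnus ordering refines the lexicographic ordering of exponent sums. -/
theorem MagnusLt.expSum_lex {u v : FreeGroup (Fin k)} (h : MagnusLt u v) :
    expSum u = expSum v ∨ ∃ a, (∀ b < a, expSum u b = expSum v b) ∧ expSum u a < expSum v a := by
  obtain ⟨w, hw, hlt⟩ := h
  match w, hw, hlt with
  | [], hw, hlt => simp [magnus_nil] at hlt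
  | [a], hw, hlt =>
    exact Or.inr ⟨a, fun b hb => hw [b] ((List.shortlex_singleton_iff b a).2 hb), hlt⟩
  | a :: b :: w, hw, hlt =>
    exact Or.inl (funext fun c => hw [c] (List.Shortlex.of_length_lt (by simp)))

theorem MagnusLt.of_expSum {u v : FreeGroup (Fin k)} (a : Fin k)
    (hb : ∀ b < a, expSum u b = expSum v b) (ha : expSum u a < expSum v a) : MagnusLt u v := by
  refine ⟨[a], fun w hw => ?_, ha⟩
  match w, hw with
  | [], _ => rw [magnus_nil, magnus_nil]
  | [b], hw => exact hb b ((List.shortlex_singleton_iff b a).1 hw)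
  | b :: c :: w, hw =>
    rw [List.shortlex_def] at hw
    simp at hw

end Magnus

/-! ### The half twist automorphisms of a free group -/

/-- Two automorphisms of a free group agree if they agree on the generators. -/
theorem FreeGroup.mulAut_ext {α : Type*} {φ ψ : MulAut (FreeGroup α)}
    (h : ∀ c, φ (.of c) = ψ (.of c)) : φ = ψ :=
  MulEquiv.toMonoidHom_injective (FreeGroup.ext_hom _ _ h)

section HalfTwist

variable {α : Type*} [DecidableEq α]

/-- The automorphism `x a ↦ x b`, `x b ↦ (x b)⁻¹ x a x b` of the free group, which fixes the other
generators; Artin's action of a braid generator. -/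
def halfTwist (a b : α) (hab : a ≠ b) : MulAut (FreeGroup α) :=
  MonoidHom.toMulEquiv
    (FreeGroup.lift fun c => if c = a then .of b else
      if c = b then (.of b)⁻¹ * .of a * .of b else .of c)
    (FreeGroup.lift fun c => if c = b then .of a else
      if c = a then .of a * .of b * (.of a)⁻¹ else .of c)
    (by
      ext1 c
      by_cases ha : c = a
      · subst ha; simp
      · by_cases hb : c = b
        · subst hb; simp [hab, hab.symm, mul_assoc]
        · simp [ha, hb])
    (by
      ext1 c
      by_cases hb : c = b
      · subst hb; simp
      · by_cases ha : c = a
        · subst ha; simp [hab, hab.symm, mul_assoc]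
        · simp [ha, hb])

variable {a b : α} (hab : a ≠ b)

theorem halfTwist_of (c : α) : halfTwist a b hab (.of c) = if c = a then .of b else
    if c = b then (.of b)⁻¹ * .of a * .of b else .of c := by
  simp [halfTwist]

theorem halfTwist_of_left : halfTwist a b hab (.of a) = .of b := by
  rw [halfTwist_of, if_pos rfl]

theorem halfTwist_of_right : halfTwist a b hab (.of b) = (.of b)⁻¹ * .of a * .of b := by
  rw [halfTwist_of, if_neg hab.symm, if_pos rfl]

theorem halfTwist_of_ne {c : α} (ha : c ≠ a) (hb : c ≠ b) :
    halfTwist a b hab (.of c) = .of c := by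
  rw [halfTwist_of, if_neg ha, if_neg hb]

theorem halfTwist_commute {c d : α} (hcd : c ≠ d) (hac : a ≠ c) (had : a ≠ d) (hbc : b ≠ c)
    (hbd : b ≠ d) : Commute (halfTwist a b hab) (halfTwist c d hcd) := by
  refine FreeGroup.mulAut_ext fun e => ?_
  simp only [MulAut.mul_apply, halfTwist_of]
  by_cases h1 : e = a
  · subst h1
    simp [halfTwist_of, hac, had, hbc, hbd]
  by_cases h2 : e = b
  · subst h2
    simp [halfTwist_of, hac, had, hbc, hbd, h1]
  by_cases h3 : e = c
  · subst h3
    simp [halfTwist_of, h1, h2, had.symm, hbd.symm]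
  by_cases h4 : e = d
  · subst h4
    simp [halfTwist_of, h1, h2, h3, hac.symm, hbc.symm]
  simp [halfTwist_of, h1, h2, h3, h4]

theorem halfTwist_braid {c : α} (hbc : b ≠ c) (hac : a ≠ c) :
    halfTwist a b hab * halfTwist b c hbc * halfTwist a b hab =
      halfTwist b c hbc * halfTwist a b hab * halfTwist b c hbc := by
  refine FreeGroup.mulAut_ext fun e => ?_
  simp only [MulAut.mul_apply, halfTwist_of]
  by_cases h1 : e = a
  · subst h1
    simp [halfTwist_of, hab, hac, hac.symm, hbc.symm]
  by_cases h2 : e = b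
  · subst h2
    simp [halfTwist_of, hab, hac, hac.symm, hab.symm, hbc.symm, mul_assoc]
  by_cases h3 : e = c
  · subst h3
    simp [halfTwist_of, hac, hac.symm, hab, hab.symm, hbc.symm, mul_assoc]
  simp [halfTwist_of, h1, h2, h3]

end HalfTwist

/-- A half twist permutes the exponent sums. -/
theorem expSum_halfTwist {k : ℕ} {a b : Fin k} (hab : a ≠ b) (u : FreeGroup (Fin k)) (c : Fin k) :
    expSum (halfTwist a b hab u) (Equiv.swap a b c) = expSum u c := by
  induction u using FreeGroup.induction_on with
  | C1 => rw [map_one, expSum_one, expSum_one]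
  | of d =>
    rw [expSum_of, halfTwist_of]
    by_cases hda : d = a
    · subst hda
      rw [if_pos rfl, expSum_of]
      simp [Equiv.swap_apply_eq_iff]
    · by_cases hdb : d = b
      · subst hdb
        rw [if_neg hda, if_pos rfl, expSum_mul, expSum_mul, expSum_inv, expSum_of, expSum_of]
        simp [Equiv.swap_apply_eq_iff]
      · rw [if_neg hda, if_neg hdb, expSum_of]
        simp [Equiv.swap_apply_eq_iff, Equiv.swap_apply_of_ne_of_ne hda hdb]
  | inv_of d h => rw [map_inv, expSum_inv, expSum_inv, h]
  | mul x y hx hy => rw [map_mul, expSum_mul, expSum_mul, hx, hy]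

/-! ### Braid generators indexed by natural numbers -/

namespace BraidGroup

variable {n : ℕ}

/-- The generator `σ i`, extended by `1` to all natural numbers `i`. -/
def gen (n i : ℕ) : BraidGroup n := if h : i < n - 1 then σ ⟨i, h⟩ else 1

theorem gen_val (i : Fin (n - 1)) : gen n i = σ i := dif_pos i.2

theorem gen_commute {i j : ℕ} (hij : i + 1 < j) : Commute (gen n i) (gen n j) := by
  unfold gen
  split_ifs with hi hj
  · exact mul_inv_eq_one.1 (PresentedGroup.one_of_mem (rels := braidRels n)
      (Or.inl ⟨⟨i, hi⟩, ⟨j, hj⟩, hij, rfl⟩))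
  · exact Commute.one_right _
  · exact Commute.one_left _
  · exact Commute.one_left _

theorem gen_braid {i : ℕ} (hi : i + 1 < n - 1) :
    gen n i * gen n (i + 1) * gen n i = gen n (i + 1) * gen n i * gen n (i + 1) := by
  unfold gen
  rw [dif_pos hi, dif_pos (by omega)]
  exact mul_inv_eq_one.1 (PresentedGroup.one_of_mem (rels := braidRels n)
      (Or.inr ⟨⟨i, by omega⟩, ⟨i + 1, hi⟩, rfl, rfl⟩))

/-- The descending product `σ (m - 1) ⋯ σ (j + 1) σ j`, which is `1` for `m ≤ j`. -/
def desc (n j : ℕ) : ℕ → BraidGroup n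
  | 0 => 1
  | m + 1 => if j ≤ m then gen n m * desc n j m else 1

theorem desc_succ {j m : ℕ} (h : j ≤ m) : desc n j (m + 1) = gen n m * desc n j m := if_pos h

theorem desc_of_le {j m : ℕ} (h : m ≤ j) : desc n j m = 1 := by
  cases m with
  | zero => rfl
  | succ m => exact if_neg (by omega)

theorem desc_eq_mul_gen {j m : ℕ} (h : j < m) : desc n j m = desc n (j + 1) m * gen n j := by
  induction m, h using Nat.le_induction with
  | base => rw [desc_succ le_rfl, desc_of_le le_rfl, desc_of_le le_rfl, mul_one, one_mul]
  | succ m hm ih => rw [desc_succ (by omega), desc_succ hm, ih, mul_assoc]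

theorem gen_commute_desc_of_lt {i j : ℕ} (h : i + 1 < j) (m : ℕ) :
    Commute (gen n i) (desc n j m) := by
  induction m with
  | zero => exact Commute.one_right _
  | succ m ih =>
    by_cases hj : j ≤ m
    · rw [desc_succ hj]
      exact (gen_commute (by omega)).mul_right ih
    · rw [desc_of_le (by omega)]
      exact Commute.one_right _

theorem gen_commute_desc_of_gt {i m : ℕ} (h : m < i) (j : ℕ) :
    Commute (gen n i) (desc n j m) := by
  induction m with
  | zero => exact Commute.one_right _
  | succ m ih =>
    by_cases hj : j ≤ m
    · rw [desc_succ hj]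
      exact (gen_commute h).symm.mul_right (ih (by omega))
    · rw [desc_of_le (by omega)]
      exact Commute.one_right _

theorem desc_mul_gen {i j m : ℕ} (hj : j ≤ i) (hi : i + 1 < m) (hm : m ≤ n - 1) :
    desc n j m * gen n (i + 1) = gen n i * desc n j m := by
  induction m with
  | zero => omega
  | succ m ih =>
    rw [desc_succ (by omega)]
    rcases Nat.lt_or_ge (i + 1) m with h | h
    · rw [mul_assoc, ih h (by omega), ← mul_assoc, ← mul_assoc, (gen_commute h).eq]
    · obtain rfl : m = i + 1 := by omega
      rw [desc_succ hj]
      have h1 := gen_commute_desc_of_gt (n := n) (Nat.lt_succ_self i) j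
      have h2 := gen_braid (n := n) (i := i) (by omega)
      calc gen n (i + 1) * (gen n i * desc n j i) * gen n (i + 1)
          = gen n (i + 1) * gen n i * (desc n j i * gen n (i + 1)) := by simp only [mul_assoc]
        _ = gen n (i + 1) * gen n i * gen n (i + 1) * desc n j i := by
          rw [← h1.eq]; simp only [mul_assoc]
        _ = gen n i * (gen n (i + 1) * (gen n i * desc n j i)) := by
          rw [← h2]; simp only [mul_assoc]

/-! ### The pure braid generators and their conjugates -/

/-- The generator linking the strands `j` and `k + 1`, for natural numbers `j ≤ k`. -/
def link (n j k : ℕ) : BraidGroup n :=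
  desc n (j + 1) (k + 1) * gen n j ^ 2 * (desc n (j + 1) (k + 1))⁻¹

theorem desc_eq_prod (j k M : ℕ) :
    (((List.range M).filter fun m => j < m ∧ m ≤ k).reverse.map (gen n)).prod =
      desc n (j + 1) (min M (k + 1)) := by
  induction M with
  | zero => simp [desc_of_le]
  | succ M ih =>
    rw [List.range_succ, List.filter_append, List.reverse_append, List.map_append, List.prod_append,
      ih]
    by_cases h : j < M ∧ M ≤ k
    · have h1 : min (M + 1) (k + 1) = M + 1 := by omega
      have h2 : min M (k + 1) = M := by omega
      rw [h1, h2, desc_succ (by omega)]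
      simp [h.1, h.2]
    · have : List.filter (fun m => decide (j < m ∧ m ≤ k)) [M] = [] := by
        rw [List.filter_singleton]
        simp only [h, decide_false]
        rfl
      rw [this, List.reverse_nil, List.map_nil, List.prod_nil, one_mul]
      by_cases hj : j < M
      · have hk : k < M := by
          by_contra h'
          exact h ⟨hj, by omega⟩
        congr 1
        omega
      · rw [desc_of_le (by omega), desc_of_le (by omega)]

theorem pureGen_eq_link (k : Fin (n - 1)) (i : Fin ((k : ℕ) + 1)) : pureGen k i = link n i k := by
  have h : (((List.finRange (n - 1)).filter
      (fun m : Fin (n - 1) => (i : ℕ) < (m : ℕ) ∧ m ≤ k)).reverse.map BraidGroup.σ).prod =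
      desc n (i + 1) (k + 1) := by
    have := desc_eq_prod (n := n) i k (n - 1)
    rw [min_eq_right (by omega), ← List.map_coe_finRange_eq_range, List.filter_map,
      ← List.map_reverse, List.map_map] at this
    rw [← this]
    congr 1
    refine List.map_congr_left fun m _ => (gen_val m).symm
  unfold pureGen
  rw [h, link, ← gen_val]

/-- The relation `σ i σ (i + 1) σ i (σ (i + 1))⁻¹ (σ i)⁻¹ = σ (i + 1)`. -/
theorem gen_conj_gen {i : ℕ} (hi : i + 1 < n - 1) :
    gen n i * gen n (i + 1) * gen n i * (gen n i * gen n (i + 1))⁻¹ = gen n (i + 1) := by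
  rw [gen_braid hi]
  group

theorem gen_conj_link_self {i k : ℕ} (hi : i < k) (hk : k < n - 1) :
    gen n i * link n i k * (gen n i)⁻¹ = link n (i + 1) k := by
  have h1 : desc n (i + 1) (k + 1) = desc n (i + 2) (k + 1) * gen n (i + 1) :=
    desc_eq_mul_gen (by omega)
  have h2 := gen_commute_desc_of_lt (n := n) (Nat.lt_succ_self (i + 1)) (k + 1)
  have h3 : (gen n i * gen n (i + 1)) * gen n i ^ 2 * (gen n i * gen n (i + 1))⁻¹ =
      gen n (i + 1) ^ 2 := by
    rw [← conj_pow, gen_conj_gen (by omega)]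
  unfold link
  rw [h1]
  calc gen n i * (desc n (i + 2) (k + 1) * gen n (i + 1) * gen n i ^ 2 *
        (desc n (i + 2) (k + 1) * gen n (i + 1))⁻¹) * (gen n i)⁻¹
      = (gen n i * desc n (i + 2) (k + 1)) * gen n (i + 1) * gen n i ^ 2 *
        (gen n (i + 1))⁻¹ * (gen n i * desc n (i + 2) (k + 1))⁻¹ := by group
    _ = desc n (i + 2) (k + 1) * ((gen n i * gen n (i + 1)) * gen n i ^ 2 *
        (gen n i * gen n (i + 1))⁻¹) * (desc n (i + 2) (k + 1))⁻¹ := by rw [h2.eq]; group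
    _ = _ := by rw [h3]

theorem gen_commute_link_mul {i k : ℕ} (hi : i < k) (hk : k < n - 1) :
    Commute (gen n i) (link n i k * link n (i + 1) k) := by
  have h1 : desc n (i + 1) (k + 1) = desc n (i + 2) (k + 1) * gen n (i + 1) :=
    desc_eq_mul_gen (by omega)
  have h2 := gen_commute_desc_of_lt (n := n) (Nat.lt_succ_self (i + 1)) (k + 1)
  have hb := gen_braid (n := n) (i := i) (by omega)
  have h3 : Commute (gen n i) (gen n (i + 1) * gen n i ^ 2 * gen n (i + 1)) := by
    change gen n i * _ = _ * gen n i
    calc gen n i * (gen n (i + 1) * gen n i ^ 2 * gen n (i + 1))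
        = (gen n i * gen n (i + 1) * gen n i) * gen n i * gen n (i + 1) := by
          rw [pow_two]; simp only [mul_assoc]
      _ = gen n (i + 1) * gen n i * (gen n (i + 1) * gen n i * gen n (i + 1)) := by
          rw [hb]; simp only [mul_assoc]
      _ = _ := by rw [← hb, pow_two]; simp only [mul_assoc]
  have h4 : link n i k * link n (i + 1) k = desc n (i + 2) (k + 1) *
      (gen n (i + 1) * gen n i ^ 2 * gen n (i + 1)) * (desc n (i + 2) (k + 1))⁻¹ := by
    unfold link
    rw [h1]
    group
  rw [h4]
  exact (h2.mul_right h3).mul_right h2.inv_right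

theorem gen_conj_link_succ {i k : ℕ} (hi : i < k) (hk : k < n - 1) :
    gen n i * link n (i + 1) k * (gen n i)⁻¹ =
      (link n (i + 1) k)⁻¹ * link n i k * link n (i + 1) k := by
  have h := (gen_commute_link_mul hi hk).eq
  have h0 := gen_conj_link_self hi hk
  calc gen n i * link n (i + 1) k * (gen n i)⁻¹
      = (gen n i * link n i k * (gen n i)⁻¹)⁻¹ *
          (gen n i * (link n i k * link n (i + 1) k)) * (gen n i)⁻¹ := by group
    _ = _ := by rw [h, h0]; group

theorem gen_conj_link_of_ne {i j k : ℕ} (hi : i < k) (hk : k < n - 1) (h1 : j ≠ i)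
    (h2 : j ≠ i + 1) : gen n i * link n j k * (gen n i)⁻¹ = link n j k := by
  have key : Commute (gen n i) (link n j k) := by
    rcases Nat.lt_or_ge j i with h | h
    · have hd : gen n i * desc n (j + 1) (k + 1) = desc n (j + 1) (k + 1) * gen n (i + 1) :=
        (desc_mul_gen (by omega) (by omega) (by omega)).symm
      have hc : Commute (gen n (i + 1)) (gen n j ^ 2) := (gen_commute (by omega)).symm.pow_right 2
      have : gen n i = desc n (j + 1) (k + 1) * gen n (i + 1) * (desc n (j + 1) (k + 1))⁻¹ := by
        rw [← hd]; group
      rw [this]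
      exact (Commute.conj_iff _).2 hc
    · have hd := gen_commute_desc_of_lt (n := n) (i := i) (j := j + 1) (by omega) (k + 1)
      exact (hd.mul_right ((gen_commute (by omega)).pow_right 2)).mul_right hd.inv_right
  rw [key.eq]
  group

theorem freeFactor_of (k : Fin (n - 1)) (i : Fin ((k : ℕ) + 1)) :
    freeFactor k (.of i) = link n i k := by
  rw [freeFactor, FreeGroup.lift_apply_of, pureGen_eq_link]

/-- The half twist of two neighbouring generators of the `k`-th free factor. -/
def adjTwist {k : ℕ} (i : Fin k) : MulAut (FreeGroup (Fin (k + 1))) :=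
  halfTwist i.castSucc i.succ (Fin.castSucc_lt_succ).ne

/-- Conjugation by a generator acts on the higher free factors by Artin's automorphisms. -/
theorem gen_conj_freeFactor (k : Fin (n - 1)) (i : Fin (k : ℕ))
    (u : FreeGroup (Fin ((k : ℕ) + 1))) :
    gen n i * freeFactor k u * (gen n i)⁻¹ = freeFactor k (adjTwist i u) := by
  have key : (MulAut.conj (gen n i)).toMonoidHom.comp (freeFactor k) =
      (freeFactor k).comp (adjTwist i).toMonoidHom := by
    ext1 j
    change gen n i * freeFactor k (.of j) * (gen n i)⁻¹ = freeFactor k (adjTwist i (.of j))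
    rw [freeFactor_of, adjTwist]
    by_cases h1 : j = i.castSucc
    · subst h1
      rw [halfTwist_of_left, freeFactor_of]
      exact gen_conj_link_self i.2 k.2
    · by_cases h2 : j = i.succ
      · subst h2
        rw [halfTwist_of_right]
        simp only [map_mul, map_inv, freeFactor_of]
        exact gen_conj_link_succ i.2 k.2
      · rw [halfTwist_of_ne _ h1 h2, freeFactor_of]
        refine gen_conj_link_of_ne i.2 k.2 ?_ ?_
        · exact fun h => h1 (Fin.ext h)
        · exact fun h => h2 (Fin.ext h)
  exact DFunLike.congr_fun key u

end BraidGroup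

/-! ### The action of the braid group on cosets -/

/-- Artin's automorphism of the free group on generators indexed by the natural numbers. -/
def natTwist (i : ℕ) : MulAut (FreeGroup ℕ) := halfTwist i (i + 1) (Nat.succ_ne_self i).symm

theorem natTwist_of_left (i : ℕ) : natTwist i (.of i) = .of (i + 1) := halfTwist_of_left _

theorem natTwist_of_right (i : ℕ) :
    natTwist i (.of (i + 1)) = (.of (i + 1))⁻¹ * .of i * .of (i + 1) := halfTwist_of_right _

theorem natTwist_of_ne {i c : ℕ} (h : c ≠ i) (h' : c ≠ i + 1) : natTwist i (.of c) = .of c :=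
  halfTwist_of_ne _ h h'

theorem natTwist_commute {i j : ℕ} (h : i + 1 < j) (a : FreeGroup ℕ) :
    natTwist i (natTwist j a) = natTwist j (natTwist i a) :=
  DFunLike.congr_fun (halfTwist_commute (Nat.succ_ne_self i).symm (Nat.succ_ne_self j).symm
    (by omega) (by omega) (by omega) (by omega)) a

theorem natTwist_braid (i : ℕ) (a : FreeGroup ℕ) :
    natTwist i (natTwist (i + 1) (natTwist i a)) =
      natTwist (i + 1) (natTwist i (natTwist (i + 1) a)) :=
  DFunLike.congr_fun (halfTwist_braid (Nat.succ_ne_self i).symm (Nat.succ_ne_self (i + 1)).symm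
    (by omega)) a

/-- The action of `σ i` on pairs `(a, j)` of an element `a` of the free factor of the last strand
and a position `j`. The pair stands for the left coset of `(desc j)⁻¹ a⁻¹` modulo the braids that
only involve the other strands; here `desc j` is the positive braid that moves the strand in
position `j` to the last position. The number of strands does not occur in the formula, so that one
action serves for all free factors at once. -/
def cosetFun (i : ℕ) (p : FreeGroup ℕ × ℕ) : FreeGroup ℕ × ℕ :=
  if i + 1 < p.2 then (natTwist i p.1, p.2)
  else if p.2 = i then (p.1, i + 1)
  else if p.2 = i + 1 then (p.1 * (.of i)⁻¹, i)
  else (natTwist (i - 1) p.1, p.2)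

theorem cosetFun_of_gt {i j : ℕ} (h : i + 1 < j) (a : FreeGroup ℕ) :
    cosetFun i (a, j) = (natTwist i a, j) := if_pos h

theorem cosetFun_self (i : ℕ) (a : FreeGroup ℕ) : cosetFun i (a, i) = (a, i + 1) := by
  simp [cosetFun]

theorem cosetFun_succ (i : ℕ) (a : FreeGroup ℕ) :
    cosetFun i (a, i + 1) = (a * (.of i)⁻¹, i) := by
  simp [cosetFun]

theorem cosetFun_of_lt {i j : ℕ} (h : j < i + 1) (a : FreeGroup ℕ) :
    cosetFun (i + 1) (a, j) = (natTwist i a, j) := by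
  rw [cosetFun, if_neg (by dsimp only; omega), if_neg (by dsimp only; omega),
    if_neg (by dsimp only; omega), Nat.add_sub_cancel]

/-- The inverse of `cosetFun i`. -/
def cosetInv (i : ℕ) (p : FreeGroup ℕ × ℕ) : FreeGroup ℕ × ℕ :=
  if i + 1 < p.2 then ((natTwist i)⁻¹ p.1, p.2)
  else if p.2 = i then (p.1 * .of i, i + 1)
  else if p.2 = i + 1 then (p.1, i)
  else ((natTwist (i - 1))⁻¹ p.1, p.2)

/-- The action of `σ i` on cosets as a permutation. -/
def cosetPerm (i : ℕ) : Equiv.Perm (FreeGroup ℕ × ℕ) where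
  toFun := cosetFun i
  invFun := cosetInv i
  left_inv := by
    rintro ⟨a, j⟩
    rcases lt_trichotomy j i with h | rfl | h
    · have h1 : ¬ i + 1 < j := by omega
      simp [cosetFun, cosetInv, h1, h.ne, (show j ≠ i + 1 by omega)]
    · simp [cosetFun, cosetInv]
    · rcases (Nat.succ_le_of_lt h).eq_or_lt with rfl | h
      · simp [cosetFun, cosetInv]
      · simp [cosetFun, cosetInv, (show i + 1 < j from h)]
  right_inv := by
    rintro ⟨a, j⟩
    rcases lt_trichotomy j i with h | rfl | h
    · have h1 : ¬ i + 1 < j := by omega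
      simp [cosetFun, cosetInv, h1, h.ne, (show j ≠ i + 1 by omega)]
    · simp [cosetFun, cosetInv]
    · rcases (Nat.succ_le_of_lt h).eq_or_lt with rfl | h
      · simp [cosetFun, cosetInv]
      · simp [cosetFun, cosetInv, (show i + 1 < j from h)]

theorem cosetPerm_apply (i : ℕ) (p : FreeGroup ℕ × ℕ) : cosetPerm i p = cosetFun i p := rfl

theorem cosetPerm_commute {i i' : ℕ} (h : i + 1 < i') :
    cosetPerm i * cosetPerm i' = cosetPerm i' * cosetPerm i := by
  obtain ⟨m, rfl⟩ : ∃ m, i' = m + 1 := ⟨i' - 1, by omega⟩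
  have him : i < m := by omega
  refine Equiv.ext ?_
  rintro ⟨a, j⟩
  simp only [Equiv.Perm.mul_apply, cosetPerm_apply]
  rcases lt_trichotomy j i with hj | rfl | hj
  · obtain ⟨l, rfl⟩ : ∃ l, i = l + 1 := ⟨i - 1, by omega⟩
    have hj' : j < m + 1 := by omega
    rw [cosetFun_of_lt hj', cosetFun_of_lt hj, cosetFun_of_lt hj, cosetFun_of_lt hj',
      natTwist_commute (by omega)]
  · rw [cosetFun_of_lt (by omega), cosetFun_self, cosetFun_self, cosetFun_of_lt (by omega)]
  rcases (Nat.succ_le_of_lt hj).eq_or_lt with rfl | hj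
  · rw [cosetFun_of_lt (by omega), cosetFun_succ, cosetFun_succ, cosetFun_of_lt (by omega),
      map_mul, map_inv, natTwist_of_ne (by omega) (by omega)]
  have hj : i + 1 < j := hj
  rw [cosetFun_of_gt hj]
  rcases lt_trichotomy j (m + 1) with hj' | rfl | hj'
  · rw [cosetFun_of_lt hj', cosetFun_of_lt hj', cosetFun_of_gt hj, natTwist_commute (by omega)]
  · rw [cosetFun_self, cosetFun_self, cosetFun_of_gt (by omega)]
  rcases (Nat.succ_le_of_lt hj').eq_or_lt with rfl | hj'
  · rw [Nat.succ_eq_add_one, cosetFun_succ, cosetFun_succ, cosetFun_of_gt h,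
      map_mul, map_inv, natTwist_of_ne (by omega) (by omega)]
  · rw [cosetFun_of_gt hj', cosetFun_of_gt hj', cosetFun_of_gt hj, natTwist_commute (by omega)]

theorem cosetPerm_braid (i : ℕ) :
    cosetPerm i * cosetPerm (i + 1) * cosetPerm i =
      cosetPerm (i + 1) * cosetPerm i * cosetPerm (i + 1) := by
  refine Equiv.ext ?_
  rintro ⟨a, j⟩
  simp only [Equiv.Perm.mul_apply, cosetPerm_apply]
  rcases lt_trichotomy j i with hj | rfl | hj
  · obtain ⟨l, rfl⟩ : ∃ l, i = l + 1 := ⟨i - 1, by omega⟩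
    simp only [cosetFun_of_lt hj, cosetFun_of_lt (show j < l + 1 + 1 by omega), natTwist_braid]
  · rw [cosetFun_self, cosetFun_self, cosetFun_of_gt (Nat.lt_succ_self (j + 1)),
      cosetFun_of_lt j.lt_succ_self, cosetFun_self, cosetFun_self]
  rcases (Nat.succ_le_of_lt hj).eq_or_lt with rfl | hj
  · rw [Nat.succ_eq_add_one, cosetFun_succ, cosetFun_of_lt (by omega), cosetFun_self,
      cosetFun_self, cosetFun_of_gt (Nat.lt_succ_self (i + 1)), cosetFun_succ, map_mul, map_inv,
      natTwist_of_left]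
  rcases (Nat.succ_le_of_lt hj).eq_or_lt with rfl | hj
  · simp only [Nat.succ_eq_add_one]
    rw [cosetFun_of_gt (Nat.lt_succ_self (i + 1)), cosetFun_succ,
      cosetFun_succ, cosetFun_succ, cosetFun_succ, cosetFun_of_lt (by omega), map_mul, map_inv,
      map_mul, map_inv, natTwist_of_left, natTwist_of_right]
    simp [mul_assoc]
  · have h1 : i + 1 + 1 < j := hj
    simp only [cosetFun_of_gt h1, cosetFun_of_gt (show i + 1 < j by omega), natTwist_braid]

namespace BraidGroup

variable {n : ℕ}

/-- The action of the braid group on cosets. -/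
def cosetAction (n : ℕ) : BraidGroup n →* Equiv.Perm (FreeGroup ℕ × ℕ) :=
  PresentedGroup.toGroup (f := fun i : Fin (n - 1) => cosetPerm i) (by
    rintro r (⟨i, j, hij, rfl⟩ | ⟨i, j, hij, rfl⟩)
    · simp only [map_mul, map_inv, FreeGroup.lift_apply_of, mul_inv_eq_one]
      exact cosetPerm_commute hij
    · simp only [map_mul, map_inv, FreeGroup.lift_apply_of, mul_inv_eq_one, ← hij]
      exact cosetPerm_braid i)

theorem cosetAction_gen {i : ℕ} (hi : i < n - 1) (p : FreeGroup ℕ × ℕ) :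
    cosetAction n (gen n i) p = cosetFun i p := by
  rw [gen, dif_pos hi]
  exact congrArg (fun e : Equiv.Perm _ => e p) (PresentedGroup.toGroup.of _)

theorem cosetAction_desc {j m : ℕ} (hj : j ≤ m) (hm : m ≤ n - 1) (a : FreeGroup ℕ) :
    cosetAction n (desc n j m) (a, j) = (a, m) := by
  induction m, hj using Nat.le_induction with
  | base => rw [desc_of_le le_rfl, map_one, Equiv.Perm.one_apply]
  | succ m hjm ih =>
    rw [desc_succ hjm, map_mul, Equiv.Perm.mul_apply, ih (by omega), cosetAction_gen (by omega),
      cosetFun_self]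

theorem cosetAction_link {j k : ℕ} (hj : j ≤ k) (hk : k < n - 1) (a : FreeGroup ℕ) :
    cosetAction n (link n j k) (a, k + 1) = (a * (.of j)⁻¹, k + 1) := by
  have h : ∀ a, cosetAction n (desc n (j + 1) (k + 1)) (a, j + 1) = (a, k + 1) :=
    cosetAction_desc (by omega) (by omega)
  rw [link, map_mul, map_mul, map_inv, Equiv.Perm.mul_apply, Equiv.Perm.mul_apply,
    Equiv.Perm.inv_eq_iff_eq.2 (h a).symm, pow_two, map_mul, Equiv.Perm.mul_apply,
    cosetAction_gen (by omega), cosetAction_gen (by omega), cosetFun_succ, cosetFun_self, h]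

theorem cosetAction_freeFactor (k : Fin (n - 1)) (u : FreeGroup (Fin ((k : ℕ) + 1)))
    (a : FreeGroup ℕ) :
    cosetAction n (freeFactor k u) (a, (k : ℕ) + 1) =
      (a * (FreeGroup.map Fin.val u)⁻¹, (k : ℕ) + 1) := by
  induction u using FreeGroup.induction_on generalizing a with
  | C1 => simp
  | of i =>
    rw [freeFactor_of, cosetAction_link (by omega) k.2, FreeGroup.map.of]
  | inv_of i h =>
    rw [map_inv, map_inv, Equiv.Perm.inv_eq_iff_eq, h, map_inv, inv_inv, mul_inv_cancel_right]
  | mul x y hx hy =>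
    rw [map_mul, map_mul, Equiv.Perm.mul_apply, hy, hx, map_mul, mul_inv_rev, mul_assoc]

/-- The subgroup of the braids that only involve the strands `0, …, m`. -/
def lower (n m : ℕ) : Subgroup (BraidGroup n) := Subgroup.closure (gen n '' Set.Iio m)

theorem gen_mem_lower {i m : ℕ} (h : i < m) : gen n i ∈ lower n m :=
  Subgroup.subset_closure ⟨i, h, rfl⟩

theorem lower_mono {m m' : ℕ} (h : m ≤ m') : lower n m ≤ lower n m' :=
  Subgroup.closure_mono (Set.image_mono (Set.Iio_subset_Iio h))

theorem desc_mem_lower (j m : ℕ) : desc n j m ∈ lower n m := by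
  induction m with
  | zero => exact one_mem _
  | succ m ih =>
    by_cases h : j ≤ m
    · rw [desc_succ h]
      exact mul_mem (gen_mem_lower m.lt_succ_self) (lower_mono m.le_succ ih)
    · rw [desc_of_le (by omega)]
      exact one_mem _

theorem freeFactor_mem_lower (k : Fin (n - 1)) (u : FreeGroup (Fin ((k : ℕ) + 1))) :
    freeFactor k u ∈ lower n (k + 1) := by
  induction u using FreeGroup.induction_on with
  | C1 => rw [map_one]; exact one_mem _
  | of i =>
    rw [freeFactor_of, link]
    exact mul_mem (mul_mem (desc_mem_lower _ _) (pow_mem (gen_mem_lower i.2) 2))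
      (inv_mem (desc_mem_lower _ _))
  | inv_of i h => rw [map_inv]; exact inv_mem h
  | mul x y hx hy => rw [map_mul]; exact mul_mem hx hy

theorem cosetAction_lower {m : ℕ} (hm : m < n - 1) {g : BraidGroup n} (hg : g ∈ lower n m) :
    cosetAction n g (1, m + 1) = (1, m + 1) := by
  induction hg using Subgroup.closure_induction with
  | mem x hx =>
    obtain ⟨i, hi, rfl⟩ := hx
    have hi : i < m := hi
    rw [cosetAction_gen (by omega), cosetFun_of_gt (by omega), map_one]
  | one => simp
  | mul x y _ _ hx hy => rw [map_mul, Equiv.Perm.mul_apply, hy, hx]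
  | inv x _ hx => rw [map_inv, Equiv.Perm.inv_eq_iff_eq, hx]

/-! ### Uniqueness of Artin coordinates -/

/-- The product of the images of the first `m` coordinates of `w`. -/
def partialProd (w : (k : Fin (n - 1)) → FreeGroup (Fin ((k : ℕ) + 1))) : ℕ → BraidGroup n
  | 0 => 1
  | m + 1 => partialProd w m * if h : m < n - 1 then freeFactor ⟨m, h⟩ (w ⟨m, h⟩) else 1

variable {w w' : (k : Fin (n - 1)) → FreeGroup (Fin ((k : ℕ) + 1))}

theorem partialProd_succ (k : Fin (n - 1)) :
    partialProd w (k + 1) = partialProd w k * freeFactor k (w k) := by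
  rw [partialProd, dif_pos k.2]

theorem partialProd_congr {m : ℕ} (h : ∀ k : Fin (n - 1), (k : ℕ) < m → w k = w' k) :
    partialProd w m = partialProd w' m := by
  induction m with
  | zero => rfl
  | succ m ih =>
    rw [partialProd, partialProd, ih fun k hk => h k (by omega)]
    split_ifs with hm
    · rw [h ⟨m, hm⟩ m.lt_succ_self]
    · rfl

theorem partialProd_eq_prod_ofFn {m : ℕ} (hm : m ≤ n - 1) :
    partialProd w m =
      (List.ofFn fun k : Fin m => freeFactor (k.castLE hm) (w (k.castLE hm))).prod := by
  induction m with
  | zero => rfl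
  | succ m ih =>
    rw [List.ofFn_succ', List.concat_eq_append, List.prod_append, List.prod_singleton]
    exact (partialProd_succ ⟨m, hm⟩).trans (congrArg (· * _) (ih (by omega)))

theorem isArtinCoordinates_iff {β : PureBraidGroup n} :
    IsArtinCoordinates β w ↔ (β : BraidGroup n) = partialProd w (n - 1) := by
  rw [partialProd_eq_prod_ofFn le_rfl]
  rfl

theorem partialProd_mem_lower (w : (k : Fin (n - 1)) → FreeGroup (Fin ((k : ℕ) + 1))) (m : ℕ) :
    partialProd w m ∈ lower n m := by
  induction m with
  | zero => exact one_mem _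
  | succ m ih =>
    rw [partialProd]
    refine mul_mem (lower_mono m.le_succ ih) ?_
    split_ifs with h
    · exact freeFactor_mem_lower ⟨m, h⟩ _
    · exact one_mem _

/-- The inverse of a product of coordinates moves the base point `(1, k + 1)` to the last
coordinate, because the other coordinates fix this point. -/
theorem cosetAction_partialProd_inv (k : Fin (n - 1)) :
    cosetAction n (partialProd w (k + 1))⁻¹ (1, (k : ℕ) + 1) =
      (FreeGroup.map Fin.val (w k), (k : ℕ) + 1) := by
  rw [partialProd_succ, mul_inv_rev, ← map_inv (freeFactor k), map_mul, Equiv.Perm.mul_apply,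
    cosetAction_lower k.2 (inv_mem (partialProd_mem_lower w k)), cosetAction_freeFactor, map_inv,
    inv_inv, one_mul]

theorem eq_of_partialProd_eq {m : ℕ} (hm : m ≤ n - 1) (h : partialProd w m = partialProd w' m) :
    ∀ k : Fin (n - 1), (k : ℕ) < m → w k = w' k := by
  induction m with
  | zero => exact fun k hk => absurd hk (Nat.not_lt_zero _)
  | succ m ih =>
    let k : Fin (n - 1) := ⟨m, hm⟩
    have hk : w k = w' k := by
      have h1 := cosetAction_partialProd_inv (w := w) k
      have h2 := cosetAction_partialProd_inv (w := w') k
      rw [show partialProd w ((k : ℕ) + 1) = partialProd w' (k + 1) from h, h2, Prod.mk.injEq] at h1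
      exact (FreeGroup.map_injective Fin.val_injective h1.1).symm
    have h' : partialProd w m = partialProd w' m := by
      have h1 := partialProd_succ (w := w) k
      have h2 := partialProd_succ (w := w') k
      rw [show partialProd w ((k : ℕ) + 1) = partialProd w' (k + 1) from h, h2, hk] at h1
      exact (mul_right_cancel h1).symm
    intro l hl
    rcases Nat.lt_succ_iff_lt_or_eq.1 hl with hl | hl
    · exact ih (by omega) h' l hl
    · obtain rfl : l = k := Fin.ext hl
      exact hk

end BraidGroup

/-! ### The action of braids on strands and on free factors -/

namespace BraidGroup

variable {n : ℕ}

/-- The permutation of the strands induced by a braid, extended by the identity to all natural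
numbers. -/
noncomputable def natPerm (n : ℕ) : BraidGroup n →* Equiv.Perm ℕ :=
  (Equiv.Perm.viaEmbeddingHom Fin.valEmbedding).comp (toPerm n)

theorem natPerm_eq_one_iff {g : BraidGroup n} : natPerm n g = 1 ↔ g ∈ PureBraidGroup n := by
  rw [MonoidHom.mem_ker, natPerm, MonoidHom.comp_apply,
    map_eq_one_iff _ (Equiv.Perm.viaEmbeddingHom_injective _)]

theorem natPerm_gen {i : ℕ} (hi : i < n - 1) : natPerm n (gen n i) = Equiv.swap i (i + 1) := by
  rw [gen, dif_pos hi, natPerm, MonoidHom.comp_apply,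
    show toPerm n (σ ⟨i, hi⟩) = adjacentSwap ⟨i, hi⟩ from PresentedGroup.toGroup.of _,
    Equiv.Perm.viaEmbeddingHom_apply]
  refine Equiv.ext fun x => ?_
  by_cases hx : x < n
  · have := Equiv.Perm.viaEmbedding_apply (adjacentSwap ⟨i, hi⟩) Fin.valEmbedding ⟨x, hx⟩
    rw [Fin.valEmbedding_apply] at this
    refine this.trans ?_
    rw [adjacentSwap, Equiv.swap_apply_def, Equiv.swap_apply_def]
    simp only [Fin.mk.injEq]
    split_ifs <;> rfl
  · rw [Equiv.Perm.viaEmbedding_apply_of_notMem, Equiv.swap_apply_of_ne_of_ne]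
    · omega
    · omega
    · rintro ⟨y, rfl⟩
      exact hx y.2

theorem natPerm_lower {m x : ℕ} (hm : m ≤ n - 1) (hx : m < x) {g : BraidGroup n}
    (hg : g ∈ lower n m) : natPerm n g x = x := by
  induction hg using Subgroup.closure_induction with
  | mem y hy =>
    obtain ⟨i, hi, rfl⟩ := hy
    have hi : i < m := hi
    rw [natPerm_gen (by omega), Equiv.swap_apply_of_ne_of_ne (by omega) (by omega)]
  | one => simp
  | mul y z _ _ hy hz => rw [map_mul, Equiv.Perm.mul_apply, hz, hy]
  | inv y _ hy => rw [map_inv, Equiv.Perm.inv_eq_iff_eq, hy]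

theorem natPerm_desc {j m : ℕ} (hj : j ≤ m) (hm : m ≤ n - 1) : natPerm n (desc n j m) j = m := by
  induction m, hj using Nat.le_induction with
  | base => simp [desc_of_le le_rfl]
  | succ m hjm ih =>
    rw [desc_succ hjm, map_mul, Equiv.Perm.mul_apply, ih (by omega), natPerm_gen (by omega),
      Equiv.swap_apply_left]

theorem natPerm_freeFactor (k : Fin (n - 1)) (u : FreeGroup (Fin ((k : ℕ) + 1))) :
    natPerm n (freeFactor k u) = 1 := by
  have h : (natPerm n).comp (freeFactor k) = 1 := by
    ext1 i
    rw [MonoidHom.comp_apply, freeFactor_of, link, map_mul, map_mul, map_pow,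
      natPerm_gen (by omega), pow_two, Equiv.swap_mul_self, mul_one, map_inv, mul_inv_cancel]
    rfl
  exact DFunLike.congr_fun h u

theorem natPerm_partialProd (w : (k : Fin (n - 1)) → FreeGroup (Fin ((k : ℕ) + 1))) (m : ℕ) :
    natPerm n (partialProd w m) = 1 := by
  induction m with
  | zero => exact map_one _
  | succ m ih =>
    rw [partialProd, map_mul, ih, one_mul]
    split_ifs
    · exact natPerm_freeFactor _ _
    · exact map_one _

/-- Conjugation by a braid on the strands `0, …, k` induces an automorphism of the `k`-th free
factor, which permutes the exponent sums in the way the braid permutes the strands. -/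
theorem exists_conj_freeFactor (k : Fin (n - 1)) {g : BraidGroup n} (hg : g ∈ lower n k) :
    ∃ (θ : MulAut (FreeGroup (Fin ((k : ℕ) + 1)))) (π : Equiv.Perm (Fin ((k : ℕ) + 1))),
      (∀ u, g * freeFactor k u * g⁻¹ = freeFactor k (θ u)) ∧
      (∀ c : Fin ((k : ℕ) + 1), natPerm n g c = π c) ∧ ∀ u c, expSum (θ u) (π c) = expSum u c := by
  induction hg using Subgroup.closure_induction with
  | mem x hx =>
    obtain ⟨i, hi, rfl⟩ := hx
    have hi : i < (k : ℕ) := hi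
    refine ⟨adjTwist ⟨i, hi⟩, Equiv.swap (Fin.castSucc ⟨i, hi⟩) (Fin.succ ⟨i, hi⟩),
      gen_conj_freeFactor k ⟨i, hi⟩, fun c => ?_, expSum_halfTwist _⟩
    rw [natPerm_gen (by omega), Equiv.swap_apply_def, Equiv.swap_apply_def]
    simp only [Fin.ext_iff, Fin.val_castSucc, Fin.val_succ]
    split_ifs <;> rfl
  | one => exact ⟨1, 1, by simp, by simp, by simp⟩
  | mul x y _ _ hx hy =>
    obtain ⟨θ, π, h1, h2, h3⟩ := hx
    obtain ⟨θ', π', h1', h2', h3'⟩ := hy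
    refine ⟨θ * θ', π * π', fun u => ?_, fun c => ?_, fun u c => ?_⟩
    · rw [MulAut.mul_apply, ← h1, ← h1']
      group
    · rw [map_mul, Equiv.Perm.mul_apply, h2', h2, Equiv.Perm.mul_apply]
    · rw [MulAut.mul_apply, Equiv.Perm.mul_apply, h3, h3']
  | inv x _ hx =>
    obtain ⟨θ, π, h1, h2, h3⟩ := hx
    refine ⟨θ⁻¹, π⁻¹, fun u => ?_, fun c => ?_, fun u c => ?_⟩
    · have := h1 (θ⁻¹ u)
      rw [MulAut.apply_inv_self] at this
      rw [← this]
      group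
    · rw [map_inv, Equiv.Perm.inv_eq_iff_eq, h2, ← Equiv.Perm.mul_apply π, mul_inv_cancel,
        Equiv.Perm.one_apply]
    · rw [← h3, MulAut.apply_inv_self, ← Equiv.Perm.mul_apply π, mul_inv_cancel,
        Equiv.Perm.one_apply]

/-- Conjugation by a pure braid on the strands `0, …, k` preserves the Magnus ordering of the
`k`-th free factor. -/
theorem exists_conj_freeFactor_of_pure (k : Fin (n - 1)) {g : BraidGroup n} (hg : g ∈ lower n k)
    (hp : natPerm n g = 1) :
    ∃ θ : FreeGroup (Fin ((k : ℕ) + 1)) → FreeGroup (Fin ((k : ℕ) + 1)),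
      (∀ u, g * freeFactor k u * g⁻¹ = freeFactor k (θ u)) ∧
      ∀ u v, MagnusLt u v → MagnusLt (θ u) (θ v) := by
  obtain ⟨θ, π, h1, h2, h3⟩ := exists_conj_freeFactor k hg
  -- The permutation `π` is trivial, so `θ` is trivial on the abelianization.
  refine ⟨θ, h1, fun u v h => MagnusLt.map (θ := θ.toMonoidHom) (fun u a => ?_) h⟩
  have : π a = a := by
    apply Fin.ext
    rw [← h2, hp, Equiv.Perm.one_apply]
  conv_lhs => rw [← this]
  exact h3 u a

/-! ### Existence of Artin coordinates -/

/-- The exponent sums of all generators are nonnegative. -/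
def ExpNonneg {k : ℕ} (u : FreeGroup (Fin k)) : Prop := ∀ a, 0 ≤ expSum u a

theorem expSum_adjTwist_symm {k : ℕ} (i : Fin k) (u : FreeGroup (Fin (k + 1))) (c : Fin (k + 1)) :
    expSum ((adjTwist i)⁻¹ u) c = expSum u (Equiv.swap i.castSucc i.succ c) := by
  have h := expSum_halfTwist (Fin.castSucc_lt_succ (i := i)).ne ((adjTwist i)⁻¹ u) c
  rw [← h]
  exact congrArg (fun v => expSum v _) (MulAut.apply_inv_self _ (adjTwist i) u)

theorem freeFactor_mul_gen (k : Fin (n - 1)) (i : Fin (k : ℕ)) (u : FreeGroup (Fin ((k : ℕ) + 1))) :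
    freeFactor k u * gen n i = gen n i * freeFactor k ((adjTwist i)⁻¹ u) := by
  have h := gen_conj_freeFactor k i ((adjTwist i)⁻¹ u)
  rw [MulAut.apply_inv_self] at h
  rw [← h]
  group

theorem freeFactor_mul_gen_inv (k : Fin (n - 1)) (i : Fin (k : ℕ))
    (u : FreeGroup (Fin ((k : ℕ) + 1))) :
    freeFactor k u * (gen n i)⁻¹ = (gen n i)⁻¹ * freeFactor k (adjTwist i u) := by
  rw [← gen_conj_freeFactor]
  group

theorem desc_mul_gen_self (k : Fin (n - 1)) (i : Fin ((k : ℕ) + 1)) :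
    desc n i (k + 1) * gen n i = freeFactor k (.of i) * desc n (i + 1) (k + 1) := by
  rw [freeFactor_of, link, desc_eq_mul_gen i.2, pow_two]
  group

/-- Right multiplication of a normal form `u * desc j` by a generator. What is left over on the left
side is at most one generator, which makes this step compatible with positivity; and exponent sums
are permuted or increased. -/
theorem normalForm_mul_gen (k : Fin (n - 1)) (u : FreeGroup (Fin ((k : ℕ) + 1))) {i j : ℕ}
    (hi : i ≤ k) (hj : j ≤ (k : ℕ) + 1) :
    ∃ (c : BraidGroup n) (u' : FreeGroup (Fin ((k : ℕ) + 1))) (j' : ℕ), j' ≤ (k : ℕ) + 1 ∧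
      (c = 1 ∨ ∃ i' < (k : ℕ), c = gen n i') ∧
      freeFactor k u * desc n j (k + 1) * gen n i = c * (freeFactor k u' * desc n j' (k + 1)) ∧
      (ExpNonneg u → ExpNonneg u') := by
  rcases lt_trichotomy i j with h | rfl | h
  -- For `j = i + 1` the coset representative absorbs the generator; for `j > i + 1` the generator
  -- commutes with it.
  · rcases (Nat.succ_le_of_lt h).eq_or_lt with rfl | h
    · refine ⟨1, u, i, by omega, Or.inl rfl, ?_, id⟩
      rw [desc_eq_mul_gen (j := i) (by omega), one_mul, mul_assoc]
    · have hik : i < (k : ℕ) := by omega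
      refine ⟨gen n i, (adjTwist ⟨i, hik⟩)⁻¹ u, j, hj, Or.inr ⟨i, hik, rfl⟩, ?_, fun hu a => ?_⟩
      · rw [mul_assoc, ← (gen_commute_desc_of_lt h _).eq, ← mul_assoc, ← mul_assoc]
        exact congrArg (· * _) (freeFactor_mul_gen k ⟨i, hik⟩ u)
      · rw [expSum_adjTwist_symm]
        exact hu _
  -- For `j = i` the square of the generator is split off as a generator of the free factor.
  · refine ⟨1, u * .of ⟨i, by omega⟩, i + 1, by omega, Or.inl rfl, ?_, fun hu a => ?_⟩
    · rw [one_mul, map_mul, mul_assoc, mul_assoc]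
      exact congrArg (_ * ·) (desc_mul_gen_self k ⟨i, by omega⟩)
    · rw [expSum_mul, expSum_of]
      have := hu a
      split_ifs <;> omega
  -- For `j < i` the generator passes through the coset representative with its index lowered.
  · obtain ⟨l, rfl⟩ : ∃ l, i = l + 1 := ⟨i - 1, by omega⟩
    have hlk : l < (k : ℕ) := hi
    refine ⟨gen n l, (adjTwist ⟨l, hlk⟩)⁻¹ u, j, hj, Or.inr ⟨l, hlk, rfl⟩, ?_, fun hu a => ?_⟩
    · rw [mul_assoc, desc_mul_gen (by omega) (by omega) (by omega), ← mul_assoc, ← mul_assoc]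
      exact congrArg (· * _) (freeFactor_mul_gen k ⟨l, hlk⟩ u)
    · rw [expSum_adjTwist_symm]
      exact hu _

/-- Right multiplication of a normal form `u * desc j` by the inverse of a generator. -/
theorem normalForm_mul_gen_inv (k : Fin (n - 1)) (u : FreeGroup (Fin ((k : ℕ) + 1))) {i j : ℕ}
    (hi : i ≤ k) (hj : j ≤ (k : ℕ) + 1) :
    ∃ c ∈ lower n k, ∃ (u' : FreeGroup (Fin ((k : ℕ) + 1))) (j' : ℕ), j' ≤ (k : ℕ) + 1 ∧
      freeFactor k u * desc n j (k + 1) * (gen n i)⁻¹ =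
        c * (freeFactor k u' * desc n j' (k + 1)) := by
  rcases lt_trichotomy i j with h | rfl | h
  · rcases (Nat.succ_le_of_lt h).eq_or_lt with rfl | h
    · refine ⟨1, one_mem _, u * (.of ⟨i, by omega⟩)⁻¹, i, by omega, ?_⟩
      have := desc_mul_gen_self k ⟨i, by omega⟩
      rw [one_mul, map_mul, map_inv, mul_assoc, mul_assoc]
      congr 1
      rw [eq_inv_mul_iff_mul_eq, ← mul_assoc, mul_inv_eq_iff_eq_mul]
      exact this.symm
    · have hik : i < (k : ℕ) := by omega
      refine ⟨(gen n i)⁻¹, inv_mem (gen_mem_lower hik), adjTwist ⟨i, hik⟩ u, j, hj, ?_⟩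
      rw [mul_assoc, ← (gen_commute_desc_of_lt h _).inv_left.eq, ← mul_assoc, ← mul_assoc]
      exact congrArg (· * _) (freeFactor_mul_gen_inv k ⟨i, hik⟩ u)
  · refine ⟨1, one_mem _, u, i + 1, by omega, ?_⟩
    rw [desc_eq_mul_gen (j := i) (by omega)]
    group
  · obtain ⟨l, rfl⟩ : ∃ l, i = l + 1 := ⟨i - 1, by omega⟩
    have hlk : l < (k : ℕ) := hi
    refine ⟨(gen n l)⁻¹, inv_mem (gen_mem_lower hlk), adjTwist ⟨l, hlk⟩ u, j, hj, ?_⟩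
    have h' : desc n j (k + 1) * (gen n (l + 1))⁻¹ = (gen n l)⁻¹ * desc n j (k + 1) := by
      rw [mul_inv_eq_iff_eq_mul, mul_assoc, eq_inv_mul_iff_mul_eq,
        desc_mul_gen (by omega) (by omega) (by omega)]
    rw [mul_assoc, h', ← mul_assoc, ← mul_assoc]
    exact congrArg (· * _) (freeFactor_mul_gen_inv k ⟨l, hlk⟩ u)

theorem exists_normalForm (k : Fin (n - 1)) {g : BraidGroup n} (hg : g ∈ lower n (k + 1)) :
    ∃ b ∈ lower n k, ∃ (u : FreeGroup (Fin ((k : ℕ) + 1))) (j : ℕ), j ≤ (k : ℕ) + 1 ∧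
      g = b * (freeFactor k u * desc n j (k + 1)) := by
  induction hg using Subgroup.closure_induction_right with
  | one =>
    exact ⟨1, one_mem _, 1, k + 1, le_rfl, by rw [map_one, desc_of_le le_rfl, mul_one, mul_one]⟩
  | mul_right x _ y hy ih =>
    obtain ⟨b, hb, u, j, hj, rfl⟩ := ih
    obtain ⟨i, hi, rfl⟩ := hy
    obtain ⟨c, u', j', hj', hc, he, -⟩ := normalForm_mul_gen k u (Nat.lt_succ_iff.1 hi) hj
    refine ⟨b * c, mul_mem hb ?_, u', j', hj', by rw [mul_assoc, he, mul_assoc]⟩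
    rcases hc with rfl | ⟨i', hi', rfl⟩
    · exact one_mem _
    · exact gen_mem_lower hi'
  | mul_inv_cancel x _ y hy ih =>
    obtain ⟨b, hb, u, j, hj, rfl⟩ := ih
    obtain ⟨i, hi, rfl⟩ := hy
    obtain ⟨c, hc, u', j', hj', he⟩ := normalForm_mul_gen_inv k u (Nat.lt_succ_iff.1 hi) hj
    exact ⟨b * c, mul_mem hb hc, u', j', hj', by rw [mul_assoc, he, mul_assoc]⟩

/-- The monoid of the positive braids that only involve the strands `0, …, m`. -/
def lowerPos (n m : ℕ) : Submonoid (BraidGroup n) := Submonoid.closure (gen n '' Set.Iio m)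

theorem lowerPos_le_lower (m : ℕ) : lowerPos n m ≤ (lower n m).toSubmonoid :=
  Submonoid.closure_le.2 Subgroup.subset_closure

theorem lowerPos_mono {m m' : ℕ} (h : m ≤ m') : lowerPos n m ≤ lowerPos n m' :=
  Submonoid.closure_mono (Set.image_mono (Set.Iio_subset_Iio h))

theorem lowerPos_eq_closure_range :
    lowerPos n (n - 1) = Submonoid.closure (Set.range (σ (n := n))) := by
  rw [lowerPos]
  congr 1
  ext g
  constructor
  · rintro ⟨i, hi, rfl⟩
    exact ⟨⟨i, hi⟩, (gen_val ⟨i, hi⟩).symm⟩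
  · rintro ⟨i, rfl⟩
    exact ⟨i, i.2, gen_val i⟩

theorem lower_eq_top : lower n (n - 1) = ⊤ := by
  rw [lower, ← PresentedGroup.closure_range_of (braidRels n)]
  congr 1
  ext g
  constructor
  · rintro ⟨i, hi, rfl⟩
    exact ⟨⟨i, hi⟩, (gen_val ⟨i, hi⟩).symm⟩
  · rintro ⟨i, rfl⟩
    exact ⟨i, i.2, gen_val i⟩

/-- Normal forms of positive braids: the lower part is again positive, which replaces the
argument that forgetting the last strand preserves positivity. -/
theorem exists_normalForm_of_pos (k : Fin (n - 1)) {g : BraidGroup n}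
    (hg : g ∈ lowerPos n (k + 1)) :
    ∃ b ∈ lowerPos n k, ∃ (u : FreeGroup (Fin ((k : ℕ) + 1))) (j : ℕ), j ≤ (k : ℕ) + 1 ∧
      g = b * (freeFactor k u * desc n j (k + 1)) ∧ ExpNonneg u := by
  induction hg using Submonoid.closure_induction_right with
  | one =>
    exact ⟨1, one_mem _, 1, k + 1, le_rfl, by rw [map_one, desc_of_le le_rfl, mul_one, mul_one],
      fun a => (expSum_one a).ge⟩
  | mul_right x _ y hy ih =>
    obtain ⟨b, hb, u, j, hj, rfl, hu⟩ := ih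
    obtain ⟨i, hi, rfl⟩ := hy
    obtain ⟨c, u', j', hj', hc, he, hu'⟩ := normalForm_mul_gen k u (Nat.lt_succ_iff.1 hi) hj
    refine ⟨b * c, mul_mem hb ?_, u', j', hj', by rw [mul_assoc, he, mul_assoc], hu' hu⟩
    rcases hc with rfl | ⟨i', hi', rfl⟩
    · exact one_mem _
    · exact Submonoid.subset_closure ⟨i', hi', rfl⟩

/-- The permutation of a braid determines the coset representative in its normal form. -/
theorem eq_of_normalForm_pure (k : Fin (n - 1)) {b : BraidGroup n} (hb : b ∈ lower n k)
    (u : FreeGroup (Fin ((k : ℕ) + 1))) {j : ℕ} (hj : j ≤ (k : ℕ) + 1)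
    (hp : natPerm n (b * (freeFactor k u * desc n j (k + 1))) = 1) :
    j = (k : ℕ) + 1 ∧ natPerm n b = 1 := by
  have hp' := hp
  rw [map_mul, map_mul, natPerm_freeFactor, one_mul] at hp
  have h := congrArg (fun e : Equiv.Perm ℕ => e j) hp
  simp only [Equiv.Perm.mul_apply, Equiv.Perm.one_apply] at h
  rw [natPerm_desc hj (by omega), natPerm_lower (by omega) (Nat.lt_succ_self _) hb] at h
  refine ⟨h.symm, ?_⟩
  rwa [← h, desc_of_le le_rfl, map_one, mul_one] at hp

theorem partialProd_update (w : (k : Fin (n - 1)) → FreeGroup (Fin ((k : ℕ) + 1)))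
    (k : Fin (n - 1)) (u : FreeGroup (Fin ((k : ℕ) + 1))) {m : ℕ} (hm : m ≤ k) :
    partialProd (Function.update w k u) m = partialProd w m :=
  partialProd_congr fun l hl => Function.update_of_ne (fun h => by subst h; omega) _ _

theorem exists_eq_partialProd {m : ℕ} (hm : m ≤ n - 1) {g : BraidGroup n} (hg : g ∈ lower n m)
    (hp : natPerm n g = 1) : ∃ w, g = partialProd w m := by
  induction m generalizing g with
  | zero =>
    refine ⟨1, ?_⟩
    simpa [lower, partialProd] using hg
  | succ m ih =>
    let k : Fin (n - 1) := ⟨m, hm⟩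
    obtain ⟨b, hb, u, j, hj, rfl⟩ := exists_normalForm k hg
    obtain ⟨rfl, hb1⟩ := eq_of_normalForm_pure k hb u hj hp
    obtain ⟨w, rfl⟩ := ih (by omega) hb hb1
    refine ⟨Function.update w k u, ?_⟩
    rw [show partialProd (Function.update w k u) (m + 1) = _ from partialProd_succ k,
      partialProd_update w k u le_rfl, Function.update_self, desc_of_le le_rfl, mul_one]

theorem exists_eq_partialProd_of_pos {m : ℕ} (hm : m ≤ n - 1) {g : BraidGroup n}
    (hg : g ∈ lowerPos n m) (hp : natPerm n g = 1) :
    ∃ w, g = partialProd w m ∧ (∀ k : Fin (n - 1), (k : ℕ) < m → ExpNonneg (w k)) ∧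
      ∀ l ≤ m, partialProd w l ∈ lowerPos n (n - 1) := by
  induction m generalizing g with
  | zero =>
    refine ⟨1, ?_, fun k hk => absurd hk (Nat.not_lt_zero _), fun l hl => ?_⟩
    · simpa [lowerPos, partialProd] using hg
    · rw [Nat.le_zero.1 hl]
      exact one_mem _
  | succ m ih =>
    let k : Fin (n - 1) := ⟨m, hm⟩
    have hg' := hg
    obtain ⟨b, hb, u, j, hj, rfl, hu⟩ := exists_normalForm_of_pos k hg
    obtain ⟨rfl, hb1⟩ := eq_of_normalForm_pure k (lowerPos_le_lower _ hb) u hj hp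
    obtain ⟨w, rfl, hw1, hw2⟩ := ih (by omega) hb hb1
    have heq : partialProd w m * (freeFactor k u * desc n (k + 1) (k + 1)) =
        partialProd (Function.update w k u) (m + 1) := by
      rw [show partialProd (Function.update w k u) (m + 1) = _ from partialProd_succ k,
        partialProd_update w k u le_rfl, Function.update_self, desc_of_le le_rfl, mul_one]
    refine ⟨Function.update w k u, heq, fun l hl => ?_, fun l hl => ?_⟩
    · by_cases hlk : l = k
      · subst hlk
        rwa [Function.update_self]
      · rw [Function.update_of_ne hlk]
        refine hw1 l (lt_of_le_of_ne (Nat.lt_succ_iff.1 hl) fun h => hlk (Fin.ext h))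
    · rcases Nat.le_or_eq_of_le_succ hl with hl | rfl
      · rw [partialProd_update w k u hl]
        exact hw2 l hl
      · rw [← heq]
        exact lowerPos_mono hm hg'

end BraidGroup

/-! ### Word length -/

namespace BraidGroup

variable {n : ℕ}

/-- The homomorphism to the integers that sends every generator to `1`. -/
def lengthHom (n : ℕ) : BraidGroup n →* Multiplicative ℤ :=
  PresentedGroup.toGroup (f := fun _ : Fin (n - 1) => Multiplicative.ofAdd (1 : ℤ)) (by
    rintro r (⟨i, j, -, rfl⟩ | ⟨i, j, -, rfl⟩) <;> simp)

theorem lengthHom_σ (i : Fin (n - 1)) : lengthHom n (σ i) = Multiplicative.ofAdd 1 :=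
  PresentedGroup.toGroup.of _

theorem lengthHom_freeFactor (k : Fin (n - 1)) (u : FreeGroup (Fin ((k : ℕ) + 1))) :
    lengthHom n (freeFactor k u) = Multiplicative.ofAdd (2 * ∑ c, expSum u c) := by
  induction u using FreeGroup.induction_on with
  | C1 => simp [expSum_one]
  | of i =>
    have hi : (i : ℕ) < n - 1 := by omega
    rw [freeFactor_of, link, map_mul, map_mul, map_inv, mul_comm, inv_mul_cancel_left, map_pow,
      gen, dif_pos hi, lengthHom_σ, ← ofAdd_nsmul]
    simp [expSum_of]
  | inv_of i h => simp [h, expSum_inv]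
  | mul x y hx hy =>
    rw [map_mul, map_mul, hx, hy, ← ofAdd_add]
    simp [expSum_mul, Finset.sum_add_distrib, mul_add]

theorem exists_word_of_pos {g : BraidGroup n} (hg : g ∈ lowerPos n (n - 1)) :
    ∃ L : List (Fin (n - 1)), (L.map σ).prod = g ∧
      lengthHom n g = Multiplicative.ofAdd (L.length : ℤ) := by
  rw [lowerPos_eq_closure_range] at hg
  induction hg using Submonoid.closure_induction_left with
  | one => exact ⟨[], rfl, by simp⟩
  | mul_left x hx y _ ih =>
    obtain ⟨i, rfl⟩ := hx
    obtain ⟨L, rfl, hL⟩ := ih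
    refine ⟨i :: L, by simp, ?_⟩
    rw [map_mul, hL, lengthHom_σ, ← ofAdd_add, List.length_cons, Nat.cast_succ, add_comm]

theorem finite_pos_of_lengthHom (z : Multiplicative ℤ) :
    {g : BraidGroup n | g ∈ lowerPos n (n - 1) ∧ lengthHom n g = z}.Finite := by
  refine ((List.finite_length_eq (Fin (n - 1)) z.toAdd.toNat).image
    fun L => (L.map σ).prod).subset ?_
  rintro g ⟨hg, hz⟩
  obtain ⟨L, hL, hlen⟩ := exists_word_of_pos hg
  refine ⟨L, ?_, hL⟩
  rw [← hz, hlen]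
  simp

theorem eq_one_of_pos_of_lengthHom {g : BraidGroup n} (hg : g ∈ lowerPos n (n - 1))
    (h : lengthHom n g = 1) : g = 1 := by
  obtain ⟨L, rfl, hL⟩ := exists_word_of_pos hg
  rw [h, eq_comm, ofAdd_eq_one, Nat.cast_eq_zero, List.length_eq_zero_iff] at hL
  rw [hL, List.map_nil, List.prod_nil]

/-! ### The Kim–Rolfsen ordering in terms of coordinates -/

theorem existsUnique_isArtinCoordinates (β : PureBraidGroup n) :
    ∃! w : (k : Fin (n - 1)) → FreeGroup (Fin ((k : ℕ) + 1)), IsArtinCoordinates β w := by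
  obtain ⟨w, hw⟩ := exists_eq_partialProd le_rfl (g := (β : BraidGroup n))
    (by rw [lower_eq_top]; trivial) (natPerm_eq_one_iff.2 β.2)
  refine ⟨w, isArtinCoordinates_iff.2 hw, fun w' hw' => ?_⟩
  have h := isArtinCoordinates_iff.1 hw'
  rw [hw] at h
  exact funext fun k => eq_of_partialProd_eq le_rfl h.symm k k.2

/-- The Artin coordinates of a pure braid. -/
noncomputable def coords (β : PureBraidGroup n) :
    (k : Fin (n - 1)) → FreeGroup (Fin ((k : ℕ) + 1)) :=
  (existsUnique_isArtinCoordinates β).choose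

theorem isArtinCoordinates_coords (β : PureBraidGroup n) : IsArtinCoordinates β (coords β) :=
  (existsUnique_isArtinCoordinates β).choose_spec.1

theorem partialProd_coords (β : PureBraidGroup n) : partialProd (coords β) (n - 1) = β :=
  (isArtinCoordinates_iff.1 (isArtinCoordinates_coords β)).symm

theorem eq_coords {β : PureBraidGroup n} {w : (k : Fin (n - 1)) → FreeGroup (Fin ((k : ℕ) + 1))}
    (h : partialProd w (n - 1) = β) : w = coords β :=
  (existsUnique_isArtinCoordinates β).unique (isArtinCoordinates_iff.2 h.symm)
    (isArtinCoordinates_coords β)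

theorem coords_injective : Function.Injective (coords (n := n)) := fun α β h =>
  Subtype.ext (by rw [← partialProd_coords α, h, partialProd_coords])

theorem partialProd_one (m : ℕ) :
    partialProd (1 : (k : Fin (n - 1)) → FreeGroup (Fin ((k : ℕ) + 1))) m = 1 := by
  induction m with
  | zero => rfl
  | succ m ih => simp [partialProd, ih]

theorem coords_one : coords (1 : PureBraidGroup n) = 1 :=
  (eq_coords (partialProd_one _)).symm

theorem kimRolfsenLt_iff {α β : PureBraidGroup n} :
    KimRolfsenLt α β ↔
      ∃ k, (∀ j < k, coords α j = coords β j) ∧ MagnusLt (coords α k) (coords β k) := by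
  constructor
  · rintro ⟨u, v, hu, hv, h⟩
    rw [isArtinCoordinates_iff] at hu hv
    rwa [← eq_coords hu.symm, ← eq_coords hv.symm]
  · exact fun h => ⟨_, _, isArtinCoordinates_coords α, isArtinCoordinates_coords β, h⟩

/-! ### Invariance of the ordering -/

/-- The coordinates of a product: `P_n` is an iterated semidirect product, in which the lower
coordinates of the right factor act on the coordinates of the left factor, preserving the Magnus
ordering. -/
theorem exists_coords_mul (n : ℕ) :
    ∃ Θ : (k : Fin (n - 1)) → BraidGroup n →
        FreeGroup (Fin ((k : ℕ) + 1)) → FreeGroup (Fin ((k : ℕ) + 1)),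
      (∀ k : Fin (n - 1), ∀ g ∈ lower n k, natPerm n g = 1 → ∀ u v, MagnusLt u v →
        MagnusLt (Θ k g u) (Θ k g v)) ∧
      ∀ (α β : PureBraidGroup n) (k : Fin (n - 1)),
        coords (α * β) k = Θ k (partialProd (coords β) k) (coords α k) * coords β k := by
  have hex : ∀ (k : Fin (n - 1)) (g : BraidGroup n),
      ∃ θ : FreeGroup (Fin ((k : ℕ) + 1)) → FreeGroup (Fin ((k : ℕ) + 1)),
        g ∈ lower n k → natPerm n g = 1 →
          (∀ u, g⁻¹ * freeFactor k u * g = freeFactor k (θ u)) ∧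
          ∀ u v, MagnusLt u v → MagnusLt (θ u) (θ v) := by
    intro k g
    by_cases h : g ∈ lower n k ∧ natPerm n g = 1
    · obtain ⟨θ, h1, h2⟩ := exists_conj_freeFactor_of_pure k (inv_mem h.1)
        (by rw [map_inv, h.2, inv_one])
      exact ⟨θ, fun _ _ => ⟨by simpa using h1, h2⟩⟩
    · exact ⟨id, fun h1 h2 => absurd ⟨h1, h2⟩ h⟩
  choose Θ hΘ using hex
  refine ⟨Θ, fun k g hg hp => (hΘ k g hg hp).2, fun α β => ?_⟩
  let w : (k : Fin (n - 1)) → FreeGroup (Fin ((k : ℕ) + 1)) := fun k =>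
    Θ k (partialProd (coords β) k) (coords α k) * coords β k
  have key : ∀ m ≤ n - 1,
      partialProd w m = partialProd (coords α) m * partialProd (coords β) m := by
    intro m hm
    induction m with
    | zero => exact (mul_one 1).symm
    | succ m ih =>
      have hs : ∀ w : (k : Fin (n - 1)) → FreeGroup (Fin ((k : ℕ) + 1)),
          partialProd w (m + 1) = partialProd w m * freeFactor ⟨m, hm⟩ (w ⟨m, hm⟩) := fun w =>
        partialProd_succ (w := w) ⟨m, hm⟩
      have hconj := (hΘ ⟨m, hm⟩ (partialProd (coords β) m) (partialProd_mem_lower _ _)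
        (natPerm_partialProd _ _)).1 (coords α ⟨m, hm⟩)
      rw [hs, hs, hs, ih (by omega), map_mul, ← hconj]
      group
  have hw : w = coords (α * β) := eq_coords (by
    rw [key _ le_rfl, partialProd_coords, partialProd_coords]
    rfl)
  exact fun k => (congrFun hw k).symm

theorem isStrictTotalOrder_kimRolfsenLt (n : ℕ) :
    IsStrictTotalOrder (PureBraidGroup n) KimRolfsenLt where
  irrefl α h := by
    obtain ⟨k, -, hk⟩ := kimRolfsenLt_iff.1 h
    exact MagnusLt.irrefl _ hk
  trans α β γ h h' := by
    obtain ⟨k, hk, hk'⟩ := kimRolfsenLt_iff.1 h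
    obtain ⟨l, hl, hl'⟩ := kimRolfsenLt_iff.1 h'
    rw [kimRolfsenLt_iff]
    rcases lt_trichotomy k l with hkl | rfl | hkl
    · exact ⟨k, fun j hj => (hk j hj).trans (hl j (hj.trans hkl)), hl k hkl ▸ hk'⟩
    · exact ⟨k, fun j hj => (hk j hj).trans (hl j hj), hk'.trans hl'⟩
    · exact ⟨l, fun j hj => (hk j (hj.trans hkl)).trans (hl j hj), (hk l hkl).symm ▸ hl'⟩
  trichotomous α β h h' := by
    by_contra hne
    obtain ⟨k, hk, hmin⟩ := wellFounded_lt.has_min {k | coords α k ≠ coords β k}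
      (Function.ne_iff.1 fun h => hne (coords_injective h))
    have heq : ∀ j < k, coords α j = coords β j := fun j hj => by
      by_contra hj'
      exact hmin j hj' hj
    rcases MagnusLt.trichotomy (coords α k) (coords β k) with hlt | heq' | hlt
    · exact h (kimRolfsenLt_iff.2 ⟨k, heq, hlt⟩)
    · exact hk heq'
    · exact h' (kimRolfsenLt_iff.2 ⟨k, fun j hj => (heq j hj).symm, hlt⟩)

theorem isBiOrdering_kimRolfsenLt (n : ℕ) : IsBiOrdering (KimRolfsenLt (n := n)) := by
  obtain ⟨Θ, hΘ, hmul⟩ := exists_coords_mul n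
  refine ⟨isStrictTotalOrder_kimRolfsenLt n, fun x y z h => ?_, fun x y z h => ?_⟩ <;>
    obtain ⟨k, hk, hlt⟩ := kimRolfsenLt_iff.1 h <;>
    refine kimRolfsenLt_iff.2 ⟨k, fun j hj => ?_, ?_⟩
  · rw [hmul, hmul, hk j hj]
  · rw [hmul, hmul]
    exact (hΘ k _ (partialProd_mem_lower _ _) (natPerm_partialProd _ _) _ _ hlt).mul_right _
  · rw [hmul, hmul, hk j hj, partialProd_congr fun l hl => hk l (lt_trans hl hj)]
  · rw [hmul, hmul, partialProd_congr fun l hl => hk l hl]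
    exact hlt.mul_left _

/-! ### Garside-positive braids -/

theorem coords_of_garsidePositive {β : PureBraidGroup n} (hβ : GarsidePositive β) :
    (∀ k, ExpNonneg (coords β k)) ∧
      ∀ l ≤ n - 1, partialProd (coords β) l ∈ lowerPos n (n - 1) := by
  rw [GarsidePositive, ← lowerPos_eq_closure_range] at hβ
  obtain ⟨w, hw, h1, h2⟩ := exists_eq_partialProd_of_pos le_rfl hβ (natPerm_eq_one_iff.2 β.2)
  obtain rfl := eq_coords hw.symm
  exact ⟨fun k => h1 k k.2, h2⟩

theorem freeFactor_injective (k : Fin (n - 1)) : Function.Injective (freeFactor k) := by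
  intro u v h
  have hu := cosetAction_freeFactor k u 1
  rw [h, cosetAction_freeFactor, Prod.mk.injEq, one_mul, one_mul, inv_inj] at hu
  exact (FreeGroup.map_injective Fin.val_injective hu.1).symm

/-- The first non-trivial coordinate of a positive pure braid has nonnegative exponent sums. They
are not all zero, since otherwise the braid would be positive of length zero. -/
theorem one_lt_of_garsidePositive {β : PureBraidGroup n} (hβ : GarsidePositive β) (h1 : β ≠ 1) :
    KimRolfsenLt 1 β := by
  obtain ⟨hexp, hpos⟩ := coords_of_garsidePositive hβ
  obtain ⟨k, hk, hmin⟩ := wellFounded_lt.has_min {k | coords 1 k ≠ coords β k}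
    (Function.ne_iff.1 fun h => h1 (coords_injective h).symm)
  have heq : ∀ j < k, coords 1 j = coords β j := fun j hj => by
    by_contra hj'
    exact hmin j hj' hj
  refine kimRolfsenLt_iff.2 ⟨k, heq, ?_⟩
  have hprod : partialProd (coords β) (k + 1) = freeFactor k (coords β k) := by
    rw [partialProd_succ, ← partialProd_congr fun l hl => heq l hl, coords_one, partialProd_one,
      one_mul]
  have hne : expSum (coords β k) ≠ 0 := by
    intro h0
    have hg : freeFactor k (coords β k) = 1 := by
      rw [← hprod]
      refine eq_one_of_pos_of_lengthHom (hpos _ k.2) ?_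
      rw [hprod, lengthHom_freeFactor, h0]
      simp
    refine hk ?_
    rw [coords_one]
    exact (freeFactor_injective k (hg.trans (map_one _).symm)).symm
  obtain ⟨a, ha, hmin⟩ := wellFounded_lt.has_min {a | expSum (coords β k) a ≠ 0}
    (Function.ne_iff.1 hne)
  rw [coords_one]
  refine MagnusLt.of_expSum a (fun b hb => ?_) ?_
  · rw [Pi.one_apply, expSum_one]
    by_contra hb'
    exact hmin b (Ne.symm hb') hb
  · rw [Pi.one_apply, expSum_one]
    exact lt_of_le_of_ne (hexp k a) (Ne.symm ha)

instance isStrictOrder_magnusLt (k : ℕ) : IsStrictOrder (FreeGroup (Fin k)) MagnusLt where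
  irrefl := MagnusLt.irrefl
  trans _ _ _ := MagnusLt.trans

/-- The vector of exponent sums, in the lexicographic ordering of vectors of natural numbers. -/
def expVec {k : ℕ} (u : FreeGroup (Fin k)) : Lex (Fin k → ℕ) := toLex fun a => (expSum u a).toNat

theorem expSum_eq_of_expVec {k : ℕ} {u : FreeGroup (Fin k)} (hu : ExpNonneg u) (a : Fin k) :
    expSum u a = (ofLex (expVec u) a : ℕ) := (Int.toNat_of_nonneg (hu a)).symm

theorem expVec_lex_of_magnusLt {k : ℕ} {u v : FreeGroup (Fin k)} (hu : ExpNonneg u)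
    (h : MagnusLt u v) : Prod.Lex (· < ·) MagnusLt (expVec u, u) (expVec v, v) := by
  rw [Prod.lex_def]
  rcases h.expSum_lex with he | ⟨a, hb, ha⟩
  · exact Or.inr ⟨by simp only [expVec, he], h⟩
  · refine Or.inl ⟨a, fun b hba => ?_, ?_⟩
    · exact congrArg Int.toNat (hb b hba)
    · exact (Int.toNat_lt_toNat ((hu a).trans_lt ha)).2 ha

/-- Lexicographic comparison of the first `m` coordinates. -/
def CoordsLt (m : ℕ) (w w' : (k : Fin (n - 1)) → FreeGroup (Fin ((k : ℕ) + 1))) : Prop :=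
  ∃ k : Fin (n - 1), (k : ℕ) < m ∧ (∀ j < k, w j = w' j) ∧ MagnusLt (w k) (w' k)

/-- The Garside-positive braids are well-ordered by their first `m` coordinates. For fixed lower
coordinates, the exponent sums of the next coordinate form a vector of natural numbers, and for
a fixed value of this vector the product of these coordinates is a positive braid of fixed length,
so that there are only finitely many possibilities. -/
theorem wellFoundedOn_coordsLt {m : ℕ} (hm : m ≤ n - 1) :
    {β : PureBraidGroup n | GarsidePositive β}.WellFoundedOn
      (Function.onFun (CoordsLt m) coords) := by
  induction m with
  | zero =>
    refine ⟨fun β => ⟨β, fun α h => ?_⟩⟩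
    obtain ⟨k, hk, -⟩ := h
    exact absurd hk (Nat.not_lt_zero _)
  | succ m ih =>
    let k : Fin (n - 1) := ⟨m, hm⟩
    let trunc : PureBraidGroup n → (l : Fin (n - 1)) → FreeGroup (Fin ((l : ℕ) + 1)) :=
      fun β l => if l < k then coords β l else 1
    have htrunc : ∀ β l, l < k → trunc β l = coords β l := fun β l hl => if_pos hl
    have h1 : {β : PureBraidGroup n | GarsidePositive β}.WellFoundedOn
        (Function.onFun (CoordsLt m) trunc) := by
      refine (ih (by omega)).mono' fun α _ β _ => ?_
      rintro ⟨l, hl, hj, hlt⟩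
      refine ⟨l, hl, fun j hjl => ?_, ?_⟩
      · have := hj j hjl
        rwa [htrunc _ _ (hjl.trans hl), htrunc _ _ (hjl.trans hl)] at this
      · rwa [htrunc _ _ hl, htrunc _ _ hl] at hlt
    have h2 : ∀ a, ({β : PureBraidGroup n | GarsidePositive β} ∩ trunc ⁻¹' {a}).WellFoundedOn
        (Function.onFun MagnusLt fun β => coords β k) := by
      intro a
      have h3 : ({β : PureBraidGroup n | GarsidePositive β} ∩ trunc ⁻¹' {a}).WellFoundedOn
          (Function.onFun (· < ·) fun β => expVec (coords β k)) :=
        (wellFounded_lt.onFun).wellFoundedOn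
      refine (h3.prod_lex_of_wellFoundedOn_fiber (rβ := MagnusLt)
        (g := fun β => coords β k) fun e => ?_).mono' fun α hα β _ h =>
          expVec_lex_of_magnusLt ((coords_of_garsidePositive hα.1).1 k) h
      rw [← Set.wellFoundedOn_image]
      refine Set.Finite.wellFoundedOn ?_
      refine ((finite_pos_of_lengthHom (n := n) (lengthHom n (partialProd a k) *
        Multiplicative.ofAdd (2 * ∑ c, ((ofLex e c : ℕ) : ℤ)))).preimage
          (f := fun u => partialProd a k * freeFactor k u)
          ((mul_right_injective _).comp (freeFactor_injective k)).injOn).subset ?_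
      rintro _ ⟨β, ⟨⟨hβ, ha⟩, he⟩, rfl⟩
      have ha : trunc β = a := ha
      have he : expVec (coords β k) = e := he
      obtain ⟨hexp, hpos⟩ := coords_of_garsidePositive hβ
      have hlow : partialProd a k = partialProd (coords β) k :=
        partialProd_congr fun l hl => by rw [← ha, htrunc β l hl]
      refine ⟨?_, ?_⟩
      · dsimp only
        rw [hlow, ← partialProd_succ]
        exact hpos _ hm
      · rw [map_mul, lengthHom_freeFactor, ← he]
        simp only [expSum_eq_of_expVec (hexp k)]
    refine (h1.prod_lex_of_wellFoundedOn_fiber h2).mono' fun α _ β _ => ?_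
    rintro ⟨l, hl, hj, hlt⟩
    rw [Function.onFun, Prod.lex_def]
    dsimp only
    rcases Nat.lt_succ_iff_lt_or_eq.1 hl with hl | hl
    · refine Or.inl ⟨l, hl, fun j hjl => ?_, ?_⟩
      · rw [htrunc _ _ (hjl.trans hl), htrunc _ _ (hjl.trans hl), hj j hjl]
      · rwa [htrunc _ _ hl, htrunc _ _ hl]
    · obtain rfl : l = k := Fin.ext hl
      refine Or.inr ⟨funext fun j => ?_, hlt⟩
      by_cases hjl : j < k
      · rw [htrunc _ _ hjl, htrunc _ _ hjl, hj j hjl]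
      · exact (if_neg hjl).trans (if_neg hjl).symm

end BraidGroup

theorem mainTheorem2 (n : ℕ) :
    (∀ β : PureBraidGroup n, ∃! w : (k : Fin (n - 1)) → FreeGroup (Fin ((k : ℕ) + 1)),
      IsArtinCoordinates β w) ∧
    IsBiOrdering (KimRolfsenLt (n := n)) ∧
    (∀ β : PureBraidGroup n, GarsidePositive β → β ≠ 1 → KimRolfsenLt 1 β) ∧
    {β : PureBraidGroup n | GarsidePositive β}.WellFoundedOn KimRolfsenLt := by
  refine ⟨BraidGroup.existsUnique_isArtinCoordinates, BraidGroup.isBiOrdering_kimRolfsenLt n,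
    fun _ => BraidGroup.one_lt_of_garsidePositive,
    (BraidGroup.wellFoundedOn_coordsLt le_rfl).mono' ?_⟩
  intro α _ β _ h
  obtain ⟨k, hk, hlt⟩ := BraidGroup.kimRolfsenLt_iff.1 h
  exact ⟨k, k.2, hk, hlt⟩
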